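/- Let $\operatorname{Sim}^0(n)$ be the group of all transformations $x\mapsto a f(x)+v$ of the Euclidean space $\mathbb{R}^n$ with $a\in\mathbb{R}^+=(0,\infty)$, $f\in\operatorname{SO}(n)$, $v\in\mathbb{R}^n$. Identify $\mathbb{R}^+$, $\operatorname{SO}(n)$ and $\mathbb{R}^n$ with its subgroups of homotheties $x\mapsto ax$, of rotations about the origin, and of translations. For a subspace $W\subset\mathbb{R}^n$ regard $\operatorname{SO}(W)$ as the subgroup of $\operatorname{SO}(n)$ of the elements that are the identity on $W^\perp$. A connected Lie subgroup (not necessarily closed) is a subgroup generated by the exponentials of the elements of a Lie subalgebra. All products below are internal products of subgroups of $\operatorname{Sim}^0(n)$: $\times$ is direct (so the factors commute), and $\ltimes$ is semidirect with the second factor normal. **Theorem.** Let $G\subset\operatorname{Sim}^0(n)$ be a connected Lie subgroup. Then $G$ acts transitively on $\mathbb{R}^n$ if and only if $G$ is conjugate in $\operatorname{Sim}^0(n)$ to a group of one of the following types. * **Type 1:** $(\mathbb{R}^+\times H)\ltimes\mathbb{R}^n$, where $H\subset\operatorname{SO}(n)$ is a connected Lie subgroup. * **Type 2:** $H\ltimes\mathbb{R}^n$,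 where $H\subset\operatorname{SO}(n)$ is a connected Lie subgroup. * **Type 3:** $(\mathbb{R}^\Phi\times H)\ltimes\mathbb{R}^n$, where $H\subset\operatorname{SO}(n)$ is a connected Lie subgroup, $\Phi\colon\mathbb{R}^+\to\operatorname{SO}(n)$ is a continuous homomorphism, and $\mathbb{R}^\Phi=\{a\cdot\Phi(a)\mid a\in\mathbb{R}^+\}$ is the group of screw homotheties $x\mapsto a\,\Phi(a)x$. * **Type 4:** $(H\times U^\Psi)\ltimes W$, where $\mathbb{R}^n=U\oplus W$ is an orthogonal decomposition, $H\subset\operatorname{SO}(W)$ is a connected Lie subgroup, $\Psi\colon U\to\operatorname{SO}(W)$ is a continuous homomorphism with injective differential $d\Psi\colon U\to\mathfrak{so}(W)$ (equivalently, with discrete kernel), and $U^\Psi=\{\Psi(u)\cdot u\mid u\in U\}$ is the group of screw isometries $x\mapsto\Psi(u)x+u$. -/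

import Mathlib

/-- Euclidean space `ℝⁿ`. -/
abbrev Euc (n : ℕ) : Type := EuclideanSpace ℝ (Fin n)

/-- The orthogonal group `O(n)`, as the group of linear isometries of `ℝⁿ`. -/
abbrev OrthGroup (n : ℕ) : Type := Euc n ≃ₗᵢ[ℝ] Euc n

/-- The group of invertible affine transformations of `ℝⁿ`. -/
abbrev AffGroup (n : ℕ) : Type := Euc n ≃ᵃ[ℝ] Euc n

/-- The multiplicative group `ℝ⁺` of positive reals. -/
abbrev PosReal : Type := {a : ℝ // 0 < a}

/-- The special orthogonal group `SO(n)`. -/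
def SOGroup (n : ℕ) : Subgroup (OrthGroup n) where
  carrier := {f | LinearMap.det (f.toLinearEquiv : Euc n →ₗ[ℝ] Euc n) = 1}
  one_mem' := by
    change LinearMap.det (LinearMap.id : Euc n →ₗ[ℝ] Euc n) = 1
    exact LinearMap.det_id
  mul_mem' := by
    intro f g hf hg
    change LinearMap.det ((f.toLinearEquiv : Euc n →ₗ[ℝ] Euc n) *
      (g.toLinearEquiv : Euc n →ₗ[ℝ] Euc n)) = 1
    rw [map_mul, hf, hg, one_mul]
  inv_mem' := by
    intro f hf
    have h := LinearEquiv.det_symm_mul_det f.toLinearEquiv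
    have hf' : LinearMap.det (f.toLinearEquiv : Euc n →ₗ[ℝ] Euc n) = 1 := hf
    rw [hf', mul_one] at h
    exact h

/-- `SO(W)` for a subspace `W ⊆ ℝⁿ`, regarded as a subgroup of `SO(n)` in the usual way: its
elements act as the identity on the orthogonal complement of `W`. -/
def SOSub {n : ℕ} (W : Submodule ℝ (Euc n)) : Subgroup (OrthGroup n) where
  carrier := {f | f ∈ SOGroup n ∧ ∀ x ∈ Wᗮ, f x = x}
  one_mem' := ⟨one_mem _, fun _ _ => rfl⟩
  mul_mem' := by
    rintro f g ⟨hf, hf'⟩ ⟨hg, hg'⟩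
    refine ⟨mul_mem hf hg, fun x hx => ?_⟩
    change f (g x) = x
    rw [hg' x hx, hf' x hx]
  inv_mem' := by
    rintro f ⟨hf, hf'⟩
    refine ⟨inv_mem hf, fun x hx => ?_⟩
    change f.symm x = x
    rw [LinearIsometryEquiv.symm_apply_eq, hf' x hx]

/-- `Sim⁰(n)`: the transformations `x ↦ a f(x) + v` with `a > 0`, `f ∈ SO(n)`, `v ∈ ℝⁿ`. -/
def Sim0 (n : ℕ) : Subgroup (AffGroup n) where
  carrier := {g | ∃ a : PosReal, ∃ f ∈ SOGroup n, ∃ v : Euc n, ∀ x, g x = (a : ℝ) • f x + v}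
  one_mem' := ⟨1, 1, one_mem _, 0, fun x => by simp⟩
  mul_mem' := by
    rintro g g' ⟨a, f, hf, v, hg⟩ ⟨a', f', hf', v', hg'⟩
    refine ⟨a * a', f * f', mul_mem hf hf', (a : ℝ) • f v' + v, fun x => ?_⟩
    simp [AffineEquiv.mul_def, hg, hg', mul_smul, add_assoc]
  inv_mem' := by
    rintro g ⟨a, f, hf, v, hg⟩
    refine ⟨a⁻¹, f⁻¹, inv_mem hf, -(((a : ℝ)⁻¹) • f⁻¹ v), fun x => ?_⟩
    have ha : (a : ℝ) ≠ 0 := a.2.ne'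
    change g.symm x = _
    rw [AffineEquiv.symm_apply_eq, hg]
    change x = (a : ℝ) • f (((a⁻¹ : PosReal) : ℝ) • f.symm x + -((a : ℝ)⁻¹ • f.symm v)) + v
    simp [ha]

/-! ### Connected Lie subgroups -/

/-- Let `ρ` be a (faithful) representation of a group `Γ` by elements of a Banach algebra.
A subgroup `G` of `Γ` is a connected Lie subgroup (not necessarily closed) if it is generated by
the exponentials of the elements of some Lie subalgebra `𝔤`, i.e. of a linear subspace that is
closed under commutators. -/
def IsConnectedLieSubgroup {Γ A : Type*} [Group Γ] [NormedRing A] [NormedAlgebra ℝ A]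
    (ρ : Γ →* A) (G : Subgroup Γ) : Prop :=
  ∃ 𝔤 : Submodule ℝ A,
    (∀ X ∈ 𝔤, ∀ Y ∈ 𝔤, X * Y - Y * X ∈ 𝔤) ∧
    (∀ X ∈ 𝔤, ∃ g : Γ, ρ g = NormedSpace.exp X) ∧
    G = Subgroup.closure {g : Γ | ∃ X ∈ 𝔤, ρ g = NormedSpace.exp X}

/-- The standard representation of `O(n)` on `ℝⁿ`. -/
noncomputable def linRep (n : ℕ) : OrthGroup n →* (Euc n →L[ℝ] Euc n) where
  toFun f := (f.toContinuousLinearEquiv : Euc n →L[ℝ] Euc n)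
  map_one' := rfl
  map_mul' _ _ := rfl

/-- The standard linear representation of the affine group of `ℝⁿ` on `ℝⁿ × ℝ`: the
transformation `x ↦ L x + v` goes to `(x, t) ↦ (L x + t v, t)`. -/
noncomputable def affRep (n : ℕ) : AffGroup n →* (Euc n × ℝ →L[ℝ] Euc n × ℝ) where
  toFun g := LinearMap.toContinuousLinearMap
    (((g.linear : Euc n →ₗ[ℝ] Euc n).comp (LinearMap.fst ℝ (Euc n) ℝ) +
      (LinearMap.snd ℝ (Euc n) ℝ).smulRight (g 0)).prod (LinearMap.snd ℝ (Euc n) ℝ))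
  map_one' := by
    refine ContinuousLinearMap.ext fun p => Prod.ext ?_ rfl
    change p.1 + p.2 • (0 : Euc n) = p.1
    simp
  map_mul' g h := by
    have key : g (h 0) = g.linear (h 0) + g 0 := by
      have := g.map_vadd 0 (h 0)
      simpa using this
    have hl : ∀ y, (g * h).linear y = g.linear (h.linear y) := fun _ => rfl
    have h0 : (g * h) 0 = g (h 0) := rfl
    refine ContinuousLinearMap.ext fun p => Prod.ext ?_ rfl
    change (g * h).linear p.1 + p.2 • (g * h) 0 =
      g.linear (h.linear p.1 + p.2 • h 0) + p.2 • g 0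
    rw [hl, h0, key]
    simp [add_assoc]

/-! ### Products of subgroups -/

/-- `K = A × B` as an internal direct product. -/
def IsDirectProd {Γ : Type*} [Group Γ] (A B K : Subgroup Γ) : Prop :=
  (∀ a ∈ A, ∀ b ∈ B, a * b = b * a) ∧ Disjoint A B ∧ K = A ⊔ B

/-- `K = A ⋉ N` as an internal semidirect product, with `N` normal in `K`. -/
def IsSemidirectProd {Γ : Type*} [Group Γ] (A N K : Subgroup Γ) : Prop :=
  (∀ a ∈ A, ∀ x ∈ N, a * x * a⁻¹ ∈ N) ∧ Disjoint A N ∧ K = A ⊔ N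

/-! ### The building blocks -/

/-- Orthogonal transformations regarded as affine transformations. -/
noncomputable def rotHom (n : ℕ) : OrthGroup n →* AffGroup n where
  toFun f := f.toLinearEquiv.toAffineEquiv
  map_one' := rfl
  map_mul' _ _ := rfl

/-- The group of translations by the vectors of a subspace `V`. -/
def translations {n : ℕ} (V : Submodule ℝ (Euc n)) : Subgroup (AffGroup n) where
  carrier := {g | ∃ v ∈ V, ∀ x, g x = x + v}
  one_mem' := ⟨0, V.zero_mem, fun x => by simp⟩
  mul_mem' := by
    rintro g h ⟨v, hv, hg⟩ ⟨w, hw, hh⟩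
    refine ⟨w + v, V.add_mem hw hv, fun x => ?_⟩
    change g (h x) = _
    rw [hg, hh, add_assoc]
  inv_mem' := by
    rintro g ⟨v, hv, hg⟩
    refine ⟨-v, V.neg_mem hv, fun x => ?_⟩
    change g.symm x = _
    rw [AffineEquiv.symm_apply_eq, hg]
    simp

/-- The group `ℝ^Φ = {a · Φ(a) | a ∈ ℝ⁺}` of screw homotheties. -/
def screwHomotheties {n : ℕ} (Φ : PosReal →* SOGroup n) : Subgroup (AffGroup n) where
  carrier := {g | ∃ a : PosReal, ∀ x, g x = (a : ℝ) • (Φ a : OrthGroup n) x}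
  one_mem' := ⟨1, fun x => by simp⟩
  mul_mem' := by
    rintro g h ⟨a, hg⟩ ⟨b, hh⟩
    refine ⟨a * b, fun x => ?_⟩
    change g (h x) = _
    rw [hg, hh]
    simp [mul_smul]
  inv_mem' := by
    rintro g ⟨a, hg⟩
    refine ⟨a⁻¹, fun x => ?_⟩
    have ha : (a : ℝ) ≠ 0 := a.2.ne'
    change g.symm x = _
    rw [AffineEquiv.symm_apply_eq, hg, map_inv]
    change x = (a : ℝ) • (Φ a : OrthGroup n)
      (((a⁻¹ : PosReal) : ℝ) • (Φ a : OrthGroup n).symm x)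
    simp [ha]

/-- The group `ℝ⁺` of homotheties `x ↦ a x`, `a > 0`. -/
noncomputable def homotheties (n : ℕ) : Subgroup (AffGroup n) := screwHomotheties 1

/-- For the orthogonal decomposition `ℝⁿ = U ⊕ W`, `U = Wᗮ`, and a homomorphism
`Ψ : U → SO(W)`, the group `U^Ψ = {Ψ(u) · u | u ∈ U}` of screw isometries. -/
noncomputable def screwIsometries {n : ℕ} (W : Submodule ℝ (Euc n))
    (Ψ : Multiplicative Wᗮ →* SOSub W) : Subgroup (AffGroup n) where
  carrier := {g | ∃ u : Wᗮ, ∀ x,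
    g x = (Ψ (Multiplicative.ofAdd u) : OrthGroup n) x + (u : Euc n)}
  one_mem' := ⟨0, fun x => by simp⟩
  mul_mem' := by
    rintro g h ⟨u, hg⟩ ⟨v, hh⟩
    refine ⟨u + v, fun x => ?_⟩
    change g (h x) = _
    rw [hg, hh, map_add, (Ψ (Multiplicative.ofAdd u)).2.2 v v.2, ofAdd_add, map_mul]
    change _ = (Ψ (Multiplicative.ofAdd u) : OrthGroup n)
      ((Ψ (Multiplicative.ofAdd v) : OrthGroup n) x) + ((u : Euc n) + (v : Euc n))
    abel
  inv_mem' := by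
    rintro g ⟨u, hg⟩
    refine ⟨-u, fun x => ?_⟩
    change g.symm x = _
    rw [AffineEquiv.symm_apply_eq, hg, map_add,
      (Ψ (Multiplicative.ofAdd u)).2.2 _ (-u).2, ofAdd_neg, map_inv]
    change x = (Ψ (Multiplicative.ofAdd u) : OrthGroup n)
      ((Ψ (Multiplicative.ofAdd u) : OrthGroup n).symm x) + ((-u : Wᗮ) : Euc n) + (u : Euc n)
    simp

/-! ### The four types -/

/-- `K = (ℝ⁺ × H) ⋉ ℝⁿ`, with `H ⊆ SO(n)` a connected Lie subgroup. -/
def IsType1 {n : ℕ} (K : Subgroup (AffGroup n)) : Prop :=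
  ∃ H : Subgroup (OrthGroup n), H ≤ SOGroup n ∧ IsConnectedLieSubgroup (linRep n) H ∧
    ∃ D : Subgroup (AffGroup n),
      IsDirectProd (homotheties n) (H.map (rotHom n)) D ∧
      IsSemidirectProd D (translations ⊤) K

/-- `K = H ⋉ ℝⁿ`, with `H ⊆ SO(n)` a connected Lie subgroup. -/
def IsType2 {n : ℕ} (K : Subgroup (AffGroup n)) : Prop :=
  ∃ H : Subgroup (OrthGroup n), H ≤ SOGroup n ∧ IsConnectedLieSubgroup (linRep n) H ∧
    IsSemidirectProd (H.map (rotHom n)) (translations ⊤) K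

/-- `K = (ℝ^Φ × H) ⋉ ℝⁿ`, with `H ⊆ SO(n)` a connected Lie subgroup and `Φ : ℝ⁺ → SO(n)` a
(continuous) homomorphism. -/
def IsType3 {n : ℕ} (K : Subgroup (AffGroup n)) : Prop :=
  ∃ H : Subgroup (OrthGroup n), H ≤ SOGroup n ∧ IsConnectedLieSubgroup (linRep n) H ∧
    ∃ Φ : PosReal →* SOGroup n, Continuous (fun a => linRep n (Φ a)) ∧
      ∃ D : Subgroup (AffGroup n),
        IsDirectProd (screwHomotheties Φ) (H.map (rotHom n)) D ∧
        IsSemidirectProd D (translations ⊤) K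

/-- `K = (H × U^Ψ) ⋉ W`, with `ℝⁿ = U ⊕ W` an orthogonal decomposition (so `U = Wᗮ`),
`H ⊆ SO(W)` a connected Lie subgroup and `Ψ : U → SO(W)` a (continuous) homomorphism with
injective differential `dΨ : U → 𝔰𝔬(W)`. -/
def IsType4 {n : ℕ} (K : Subgroup (AffGroup n)) : Prop :=
  ∃ W : Submodule ℝ (Euc n),
    ∃ H : Subgroup (OrthGroup n), H ≤ SOSub W ∧ IsConnectedLieSubgroup (linRep n) H ∧
      ∃ Ψ : Multiplicative Wᗮ →* SOSub W,
        Continuous (fun u : Wᗮ => linRep n (Ψ (Multiplicative.ofAdd u))) ∧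
        (∃ dΨ : Wᗮ →L[ℝ] (Euc n →L[ℝ] Euc n),
          HasFDerivAt (fun u : Wᗮ => linRep n (Ψ (Multiplicative.ofAdd u))) dΨ 0 ∧
          Function.Injective dΨ) ∧
        ∃ D : Subgroup (AffGroup n),
          IsDirectProd (H.map (rotHom n)) (screwIsometries W Ψ) D ∧
          IsSemidirectProd D (translations W) K

open scoped Nat InnerProductSpace

/-! ### Exponentials of operators -/

section Exp

variable {F F' : Type*} [NormedAddCommGroup F] [NormedSpace ℝ F] [CompleteSpace F]
  [NormedAddCommGroup F'] [NormedSpace ℝ F'] [CompleteSpace F']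

theorem hasSum_exp_apply (X : F →L[ℝ] F) (x : F) :
    HasSum (fun k : ℕ => (k !⁻¹ : ℝ) • (X ^ k) x) (NormedSpace.exp X x) :=
  (NormedSpace.exp_series_hasSum_exp' (𝕂 := ℝ) X).mapL (ContinuousLinearMap.apply ℝ F x)

theorem exp_apply_mem {M : Submodule ℝ F} (hM : IsClosed (M : Set F)) {X : F →L[ℝ] F}
    (hX : ∀ x ∈ M, X x ∈ M) {x : F} (hx : x ∈ M) : NormedSpace.exp X x ∈ M := by
  have hpow : ∀ k : ℕ, (X ^ k) x ∈ M := by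
    intro k
    induction k with
    | zero => simpa using hx
    | succ k ih => rw [pow_succ']; exact hX _ ih
  exact hM.mem_of_tendsto (hasSum_exp_apply X x)
    (Filter.Eventually.of_forall fun s => M.sum_mem fun k _ => M.smul_mem _ (hpow k))

theorem exp_sub_exp_apply_mem {M : Submodule ℝ F} (hM : IsClosed (M : Set F)) {X Y : F →L[ℝ] F}
    (hX : ∀ x ∈ M, X x ∈ M) (hXY : ∀ x, X x - Y x ∈ M) (x : F) :
    NormedSpace.exp X x - NormedSpace.exp Y x ∈ M := by
  have hpow : ∀ k : ℕ, (X ^ k) x - (Y ^ k) x ∈ M := by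
    intro k
    induction k with
    | zero => simp
    | succ k ih =>
      have : (X ^ (k + 1)) x - (Y ^ (k + 1)) x
          = X ((X ^ k) x - (Y ^ k) x) + (X ((Y ^ k) x) - Y ((Y ^ k) x)) := by
        rw [pow_succ', pow_succ', map_sub]
        change X ((X ^ k) x) - Y ((Y ^ k) x) = _
        abel
      rw [this]
      exact M.add_mem (hX _ ih) (hXY _)
  refine hM.mem_of_tendsto ((hasSum_exp_apply X x).sub (hasSum_exp_apply Y x))
    (Filter.Eventually.of_forall fun s => M.sum_mem fun k _ => ?_)
  rw [← smul_sub]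
  exact M.smul_mem _ (hpow k)

theorem exp_apply_intertwine (T : F →L[ℝ] F') {X : F →L[ℝ] F} {Y : F' →L[ℝ] F'}
    (h : ∀ x, Y (T x) = T (X x)) (x : F) : NormedSpace.exp Y (T x) = T (NormedSpace.exp X x) := by
  have hpow : ∀ k : ℕ, (Y ^ k) (T x) = T ((X ^ k) x) := by
    intro k
    induction k with
    | zero => rfl
    | succ k ih =>
      rw [pow_succ', pow_succ']
      change Y ((Y ^ k) (T x)) = T (X ((X ^ k) x))
      rw [ih, h]
  refine (hasSum_exp_apply Y (T x)).unique ?_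
  simpa [hpow] using (hasSum_exp_apply X x).mapL T

theorem exp_apply_of_apply_apply_eq_zero {X : F →L[ℝ] F} {x : F} (h : X (X x) = 0) :
    NormedSpace.exp X x = x + X x := by
  refine (hasSum_exp_apply X x).unique ?_
  have hz : ∀ k ∉ Finset.range 2, (k !⁻¹ : ℝ) • (X ^ k) x = 0 := by
    intro k hk
    obtain ⟨m, rfl⟩ : ∃ m, k = m + 2 := ⟨k - 2, by simp at hk; omega⟩
    have : (X ^ (m + 2)) x = (X ^ m) (X (X x)) := by rw [pow_add, pow_two]; rfl
    rw [this, h, map_zero, smul_zero]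
  simpa [Finset.sum_range_succ] using hasSum_sum_of_ne_finset_zero hz

theorem exp_apply_of_apply_eq_zero {X : F →L[ℝ] F} {x : F} (h : X x = 0) :
    NormedSpace.exp X x = x := by
  rw [exp_apply_of_apply_apply_eq_zero (by rw [h, map_zero]), h, add_zero]

theorem clm_exp_add {X Y : F →L[ℝ] F} (h : X * Y = Y * X) :
    NormedSpace.exp (X + Y) = NormedSpace.exp X * NormedSpace.exp Y := by
  let _ := NormedAlgebra.restrictScalars ℚ ℝ (F →L[ℝ] F)
  exact NormedSpace.exp_add_of_commute h

theorem continuous_clm_exp : Continuous (NormedSpace.exp : (F →L[ℝ] F) → (F →L[ℝ] F)) := by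
  let _ := NormedAlgebra.restrictScalars ℚ ℝ (F →L[ℝ] F)
  exact NormedSpace.exp_continuous

theorem exp_conj {P Q : F →L[ℝ] F} (hPQ : P * Q = 1) (hQP : Q * P = 1) (X : F →L[ℝ] F) :
    NormedSpace.exp (P * X * Q) = P * NormedSpace.exp X * Q := by
  let _ := NormedAlgebra.restrictScalars ℚ ℝ (F →L[ℝ] F)
  exact NormedSpace.exp_units_conj (⟨P, Q, hPQ, hQP⟩ : (F →L[ℝ] F)ˣ) X

end Exp

/-! ### Rotations as exponentials of skew operators -/

theorem linRep_injective (n : ℕ) : Function.Injective (linRep n) := by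
  intro f g h
  ext1 x
  exact congrArg (fun T : Euc n →L[ℝ] Euc n => T x) h

theorem affRep_injective (n : ℕ) : Function.Injective (affRep n) := by
  intro f g h
  have hx : ∀ x t, f.linear x + t • f 0 = g.linear x + t • g 0 := fun x t =>
    congrArg (fun T : Euc n × ℝ →L[ℝ] Euc n × ℝ => (T (x, t)).1) h
  ext1 x
  have h1 := hx x 1
  have key : ∀ k : AffGroup n, k x = k.linear x + k 0 := fun k => by
    simpa using k.map_vadd 0 x
  rw [key f, key g]
  simpa using h1

/-- Skew operators. -/
def IsSkewOp {E : Type*} [NormedAddCommGroup E] [InnerProductSpace ℝ E] (A : E →L[ℝ] E) : Prop :=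
  ∀ x y, ⟪A x, y⟫_ℝ = -⟪x, A y⟫_ℝ

theorem IsSkewOp.smul {E : Type*} [NormedAddCommGroup E] [InnerProductSpace ℝ E] {A : E →L[ℝ] E}
    (hA : IsSkewOp A) (r : ℝ) : IsSkewOp (r • A) := fun x y => by
  simp [inner_smul_left, inner_smul_right, hA x y]

theorem IsSkewOp.exp_mem_unitary {E : Type*} [NormedAddCommGroup E] [InnerProductSpace ℝ E]
    [CompleteSpace E] {A : E →L[ℝ] E} (hA : IsSkewOp A) :
    NormedSpace.exp A ∈ unitary (E →L[ℝ] E) := by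
  let _ := NormedAlgebra.restrictScalars ℚ ℝ (E →L[ℝ] E)
  refine NormedSpace.exp_mem_unitary_of_mem_skewAdjoint ?_
  rw [skewAdjoint.mem_iff, ContinuousLinearMap.star_eq_adjoint]
  refine ContinuousLinearMap.ext fun x => ext_inner_right ℝ fun y => ?_
  rw [ContinuousLinearMap.adjoint_inner_left, neg_apply, inner_neg_left, hA x y, neg_neg]

/-- The orthogonal transformation `exp A` for a skew operator `A`. -/
noncomputable def expOrth {n : ℕ} (A : Euc n →L[ℝ] Euc n) (hA : IsSkewOp A) : OrthGroup n :=
  Unitary.linearIsometryEquiv ⟨NormedSpace.exp A, hA.exp_mem_unitary⟩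

theorem linRep_expOrth {n : ℕ} (A : Euc n →L[ℝ] Euc n) (hA : IsSkewOp A) :
    linRep n (expOrth A hA) = NormedSpace.exp A :=
  rfl

theorem expOrth_apply {n : ℕ} (A : Euc n →L[ℝ] Euc n) (hA : IsSkewOp A) (x : Euc n) :
    expOrth A hA x = NormedSpace.exp A x :=
  rfl

theorem expOrth_mem_SOGroup {n : ℕ} (A : Euc n →L[ℝ] Euc n) (hA : IsSkewOp A) :
    expOrth A hA ∈ SOGroup n := by
  set f := expOrth ((1 / 2 : ℝ) • A) (hA.smul _) with hf
  have hff : expOrth A hA = f * f := by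
    apply linRep_injective
    rw [map_mul, linRep_expOrth, hf, linRep_expOrth, ← clm_exp_add rfl, ← add_smul]
    norm_num
  rw [hff]
  change LinearMap.det ((f.toLinearEquiv : Euc n →ₗ[ℝ] Euc n) *
    (f.toLinearEquiv : Euc n →ₗ[ℝ] Euc n)) = 1
  rw [map_mul]
  have h := Matrix.det_of_mem_unitary (f.toMatrix_mem_unitaryGroup
    (EuclideanSpace.basisFun (Fin n) ℝ) (EuclideanSpace.basisFun (Fin n) ℝ))
  have hdet := LinearMap.det_toMatrix (EuclideanSpace.basisFun (Fin n) ℝ).toBasis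
    (f.toLinearEquiv : Euc n →ₗ[ℝ] Euc n)
  rw [← hdet]
  simpa using (Unitary.mem_iff.1 h).1

/-! ### Infinitesimal affine transformations -/

/-- The vector field `x ↦ B x + b` as an operator `(x, t) ↦ (B x + t b, 0)` on `ℝⁿ × ℝ`. -/
noncomputable def affGen (n : ℕ) :
    ((Euc n →L[ℝ] Euc n) × Euc n) →ₗ[ℝ] (Euc n × ℝ →L[ℝ] Euc n × ℝ) where
  toFun p := ContinuousLinearMap.prod
    (p.1.comp (ContinuousLinearMap.fst ℝ (Euc n) ℝ) +
      (ContinuousLinearMap.snd ℝ (Euc n) ℝ).smulRight p.2) 0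
  map_add' p q := by
    refine ContinuousLinearMap.ext fun x => Prod.ext ?_ ?_
    · simp; abel
    · simp
  map_smul' c p := by
    refine ContinuousLinearMap.ext fun x => Prod.ext ?_ ?_
    · simp [smul_smul, mul_comm c]
    · simp

theorem affGen_apply {n : ℕ} (p : (Euc n →L[ℝ] Euc n) × Euc n) (x : Euc n × ℝ) :
    affGen n p x = (p.1 x.1 + x.2 • p.2, 0) :=
  rfl

theorem affRep_apply {n : ℕ} (g : AffGroup n) (x : Euc n × ℝ) :
    affRep n g x = (g.linear x.1 + x.2 • g 0, x.2) :=
  rfl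

theorem affEquiv_apply {n : ℕ} (g : AffGroup n) (x : Euc n) : g x = g.linear x + g 0 := by
  simpa using g.map_vadd 0 x

theorem affGen_mul_sub {n : ℕ} (p q : (Euc n →L[ℝ] Euc n) × Euc n) :
    affGen n p * affGen n q - affGen n q * affGen n p =
      affGen n (p.1 * q.1 - q.1 * p.1, p.1 q.2 - q.1 p.2) := by
  refine ContinuousLinearMap.ext fun x => Prod.ext ?_ ?_
  · change (p.1 (q.1 x.1 + x.2 • q.2) + (0 : ℝ) • p.2) - (q.1 (p.1 x.1 + x.2 • p.2) + (0 : ℝ) • q.2)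
      = (p.1 (q.1 x.1) - q.1 (p.1 x.1)) + x.2 • (p.1 q.2 - q.1 p.2)
    simp only [map_add, map_smul, zero_smul, smul_sub]
    abel
  · change (0 : ℝ) - 0 = 0
    simp

theorem exp_affGen_inl {n : ℕ} (p : (Euc n →L[ℝ] Euc n) × Euc n) (x : Euc n) :
    NormedSpace.exp (affGen n p) (x, 0) = (NormedSpace.exp p.1 x, 0) :=
  exp_apply_intertwine (ContinuousLinearMap.inl ℝ (Euc n) ℝ)
    (fun y => by simp [affGen_apply]) x

theorem linear_eq_exp {n : ℕ} {g : AffGroup n} {p : (Euc n →L[ℝ] Euc n) × Euc n}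
    (h : affRep n g = NormedSpace.exp (affGen n p)) (x : Euc n) :
    g.linear x = NormedSpace.exp p.1 x := by
  have := exp_affGen_inl p x
  rw [← h, affRep_apply] at this
  simpa using congrArg Prod.fst this

theorem apply_eq_exp {n : ℕ} {g : AffGroup n} {B : Euc n →L[ℝ] Euc n} {b : Euc n}
    (hb : B b = 0) (hg : affRep n g = NormedSpace.exp (affGen n (B, b))) (x : Euc n) :
    g x = NormedSpace.exp B x + b := by
  have h1 : NormedSpace.exp (affGen n (B, b)) (0, 1) = (b, 1) := by
    rw [exp_apply_of_apply_apply_eq_zero] <;> simp [affGen_apply, hb]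
  rw [← hg, affRep_apply] at h1
  have h2 : g 0 = b := by simpa using congrArg Prod.fst h1
  rw [affEquiv_apply, linear_eq_exp hg, h2]

/-- Transformations `x ↦ exp B x + b` with `B b = 0` are exponentials of affine vector fields. -/
theorem affRep_eq_exp {n : ℕ} {g : AffGroup n} {B : Euc n →L[ℝ] Euc n} {b : Euc n}
    (hb : B b = 0) (hg : ∀ x, g x = NormedSpace.exp B x + b) :
    affRep n g = NormedSpace.exp (affGen n (B, b)) := by
  have h0 : g 0 = b := by simp [hg]
  have hlin : ∀ x, g.linear x = NormedSpace.exp B x := fun x => by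
    have := affEquiv_apply g x
    rw [hg, h0] at this
    exact (add_right_cancel this).symm
  refine ContinuousLinearMap.ext fun x => ?_
  have h1 : NormedSpace.exp (affGen n (B, b)) (0, 1) = (b, 1) := by
    rw [exp_apply_of_apply_apply_eq_zero] <;> simp [affGen_apply, hb]
  have hx : x = (x.1, 0) + x.2 • ((0 : Euc n), (1 : ℝ)) := by ext <;> simp
  rw [affRep_apply, hlin, h0]
  conv_rhs => rw [hx, map_add, map_smul, h1, exp_affGen_inl]
  simp

theorem mul_inv_mem_translations {n : ℕ} {g k : AffGroup n} {B : Euc n →L[ℝ] Euc n}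
    {b c : Euc n} {V : Submodule ℝ (Euc n)} (hg : affRep n g = NormedSpace.exp (affGen n (B, b)))
    (hk : affRep n k = NormedSpace.exp (affGen n (B, c))) (hV : ∀ v ∈ V, B v ∈ V)
    (hbc : b - c ∈ V) : g * k⁻¹ ∈ translations V := by
  have hlin : ∀ x, g.linear x = k.linear x := fun x => by
    rw [linear_eq_exp hg, linear_eq_exp hk]
  have h0 : g 0 - k 0 ∈ V := by
    have := exp_sub_exp_apply_mem (M := V.prod (⊥ : Submodule ℝ ℝ))
      (Submodule.closed_of_finiteDimensional _) (X := affGen n (B, b)) (Y := affGen n (B, c))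
      (by
        rintro ⟨x, t⟩ ⟨hx, ht⟩
        obtain rfl : t = 0 := ht
        exact ⟨by simpa [affGen_apply] using hV x hx, by simp [affGen_apply]⟩)
      (by
        rintro ⟨x, t⟩
        refine ⟨?_, by simp [affGen_apply]⟩
        simpa [affGen_apply, smul_sub] using V.smul_mem t hbc) (0, 1)
    rw [← hg, ← hk, affRep_apply, affRep_apply] at this
    simpa using this.1
  refine ⟨g 0 - k 0, h0, fun x => ?_⟩
  change g (k.symm x) = _
  rw [affEquiv_apply g, hlin]
  conv_rhs => rw [← k.apply_symm_apply x, affEquiv_apply k]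
  abel

/-! ### The Lie algebra of a connected group of similarities -/

/-- The operators of the form `s + A` with `s` real and `A` skew. -/
def IsConformalOp {E : Type*} [NormedAddCommGroup E] [InnerProductSpace ℝ E] (B : E →L[ℝ] E) :
    Prop :=
  ∃ s : ℝ, ∀ x y, ⟪B x, y⟫_ℝ = 2 * s * ⟪x, y⟫_ℝ - ⟪x, B y⟫_ℝ

theorem IsSkewOp.isConformalOp {E : Type*} [NormedAddCommGroup E] [InnerProductSpace ℝ E]
    {B : E →L[ℝ] E} (hB : IsSkewOp B) : IsConformalOp B :=
  ⟨0, fun x y => by simp [hB x y]⟩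

theorem isConformalOp_of_inner_self {E : Type*} [NormedAddCommGroup E] [InnerProductSpace ℝ E]
    {B : E →L[ℝ] E} (h : ∀ x y : E, ‖x‖ = ‖y‖ → ⟪x, B x⟫_ℝ = ⟪y, B y⟫_ℝ) : IsConformalOp B := by
  have hs : ∃ s : ℝ, ∀ x, ⟪x, B x⟫_ℝ = s * ⟪x, x⟫_ℝ := by
    by_cases he : ∃ e : E, e ≠ 0
    · obtain ⟨e, he⟩ := he
      have he' : ‖e‖ ≠ 0 := norm_ne_zero_iff.2 he
      refine ⟨⟪e, B e⟫_ℝ / ‖e‖ ^ 2, fun x => ?_⟩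
      have := h x ((‖x‖ / ‖e‖) • e) (by
        rw [norm_smul, Real.norm_of_nonneg (by positivity), div_mul_cancel₀ _ he'])
      rw [map_smul, inner_smul_left, inner_smul_right] at this
      rw [this, real_inner_self_eq_norm_sq, conj_trivial]
      field_simp
    · push Not at he
      exact ⟨0, fun x => by simp [he x]⟩
  obtain ⟨s, hs⟩ := hs
  refine ⟨s, fun x y => ?_⟩
  have hxy := hs (x + y)
  simp only [map_add, inner_add_left, inner_add_right, hs x, hs y] at hxy
  rw [real_inner_comm y (B x)]
  rw [real_inner_comm x y] at hxy
  linarith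

theorem hasDerivAt_exp_smul_apply {F : Type*} [NormedAddCommGroup F] [NormedSpace ℝ F]
    [CompleteSpace F] (X : F →L[ℝ] F) (p : F) :
    HasDerivAt (fun t : ℝ => NormedSpace.exp (t • X) p) (X p) 0 := by
  have h := hasDerivAt_exp_smul_const (𝕂 := ℝ) X (0 : ℝ)
  have h2 := ((ContinuousLinearMap.apply ℝ F p).hasFDerivAt).comp_hasDerivAt (0 : ℝ) h
  simpa [Function.comp_def] using h2

/-- A one-parameter group of similarities is generated by an infinitesimal similarity. -/
theorem exists_eq_affGen_of_exp {n : ℕ} {X : Euc n × ℝ →L[ℝ] Euc n × ℝ}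
    (h : ∀ t : ℝ, ∃ g ∈ Sim0 n, affRep n g = NormedSpace.exp (t • X)) :
    ∃ p, IsConformalOp p.1 ∧ affGen n p = X := by
  have hsnd : ∀ p, (X p).2 = 0 := by
    intro p
    have h1 := ((ContinuousLinearMap.snd ℝ (Euc n) ℝ).hasFDerivAt).comp_hasDerivAt (0 : ℝ)
      (hasDerivAt_exp_smul_apply X p)
    have h2 : (fun t : ℝ => (NormedSpace.exp (t • X) p).2) = fun _ => p.2 := by
      funext t
      obtain ⟨g, -, hg⟩ := h t
      rw [← hg, affRep_apply]
    have h3 := hasDerivAt_const (0 : ℝ) p.2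
    rw [← h2] at h3
    exact h1.unique h3
  let B : Euc n →L[ℝ] Euc n := (ContinuousLinearMap.fst ℝ (Euc n) ℝ).comp
    (X.comp (ContinuousLinearMap.inl ℝ (Euc n) ℝ))
  have hB : ∀ x, B x = (X (x, 0)).1 := fun _ => rfl
  refine ⟨(B, (X (0, 1)).1), isConformalOp_of_inner_self fun x y hxy => ?_, ?_⟩
  · have hd : ∀ x, HasDerivAt (fun t : ℝ => ‖(NormedSpace.exp (t • X) (x, (0 : ℝ))).1‖ ^ 2)
        (2 * ⟪x, B x⟫_ℝ) 0 := by
      intro x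
      have h1 := ((ContinuousLinearMap.fst ℝ (Euc n) ℝ).hasFDerivAt).comp_hasDerivAt (0 : ℝ)
        (hasDerivAt_exp_smul_apply X (x, 0))
      have h2 := h1.norm_sq
      simpa [hB] using h2
    have heq : (fun t : ℝ => ‖(NormedSpace.exp (t • X) (x, (0 : ℝ))).1‖ ^ 2) =
        fun t : ℝ => ‖(NormedSpace.exp (t • X) (y, (0 : ℝ))).1‖ ^ 2 := by
      funext t
      obtain ⟨g, ⟨a, f, -, v, hg⟩, hgX⟩ := h t
      have key : ∀ z, g.linear z = (a : ℝ) • f z := fun z => by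
        have := affEquiv_apply g z
        rw [hg z, hg 0] at this
        simpa using this.symm
      simp [← hgX, affRep_apply, key, norm_smul, hxy]
    have h1 := hd x
    rw [heq] at h1
    have := h1.unique (hd y)
    linarith
  · refine ContinuousLinearMap.ext fun p => Prod.ext ?_ ?_
    · have hp : p = (p.1, 0) + p.2 • ((0 : Euc n), (1 : ℝ)) := by ext <;> simp
      conv_rhs => rw [hp, map_add, map_smul]
      rfl
    · rw [hsnd]; rfl

/-- `G` is the connected group of similarities whose Lie algebra is the algebra `𝔰` of affine
vector fields `x ↦ B x + b`. -/
structure IsSimLieAlgebra {n : ℕ} (𝔰 : Submodule ℝ ((Euc n →L[ℝ] Euc n) × Euc n))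
    (G : Subgroup (AffGroup n)) : Prop where
  bracket_mem : ∀ p ∈ 𝔰, ∀ q ∈ 𝔰, (p.1 * q.1 - q.1 * p.1, p.1 q.2 - q.1 p.2) ∈ 𝔰
  conformal : ∀ p ∈ 𝔰, IsConformalOp p.1
  exists_exp : ∀ p ∈ 𝔰, ∃ g, affRep n g = NormedSpace.exp (affGen n p)
  eq_closure : G = Subgroup.closure {g | ∃ p ∈ 𝔰, affRep n g = NormedSpace.exp (affGen n p)}

theorem exists_isSimLieAlgebra {n : ℕ} {G : Subgroup (AffGroup n)} (hG : G ≤ Sim0 n)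
    (hconn : IsConnectedLieSubgroup (affRep n) G) : ∃ 𝔰, IsSimLieAlgebra 𝔰 G := by
  obtain ⟨𝔤, hbr, hexp, hcl⟩ := hconn
  have hgen : ∀ X ∈ 𝔤, ∃ p, IsConformalOp p.1 ∧ affGen n p = X := by
    intro X hX
    refine exists_eq_affGen_of_exp fun t => ?_
    obtain ⟨g, hg⟩ := hexp _ (𝔤.smul_mem t hX)
    refine ⟨g, hG ?_, hg⟩
    rw [hcl]
    exact Subgroup.subset_closure ⟨_, 𝔤.smul_mem t hX, hg⟩
  have hinj : Function.Injective (affGen n) := by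
    intro p q h
    have hx : ∀ x t, p.1 x + t • p.2 = q.1 x + t • q.2 := fun x t =>
      congrArg (fun T : Euc n × ℝ →L[ℝ] Euc n × ℝ => (T (x, t)).1) h
    refine Prod.ext (ContinuousLinearMap.ext fun x => ?_) ?_
    · simpa using hx x 0
    · simpa using hx 0 1
  refine ⟨𝔤.comap (affGen n), ⟨fun p hp q hq => ?_, fun p hp => ?_, fun p hp => hexp _ hp, ?_⟩⟩
  · rw [Submodule.mem_comap, ← affGen_mul_sub]
    exact hbr _ hp _ hq
  · obtain ⟨q, hq, hqp⟩ := hgen _ hp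
    rwa [← hinj hqp]
  · rw [hcl]
    congr 1
    ext g
    constructor
    · rintro ⟨X, hX, hg⟩
      obtain ⟨p, -, rfl⟩ := hgen X hX
      exact ⟨p, hX, hg⟩
    · rintro ⟨p, hp, hg⟩
      exact ⟨_, hp, hg⟩

/-- The orbit of `x₀` stays in `x₀ + V` if all the vector fields are tangent to it. -/
theorem IsSimLieAlgebra.eq_top_of_tangent {n : ℕ}
    {𝔰 : Submodule ℝ ((Euc n →L[ℝ] Euc n) × Euc n)} {G : Subgroup (AffGroup n)}
    (hS : IsSimLieAlgebra 𝔰 G) (htrans : ∀ x y : Euc n, ∃ g ∈ G, g x = y)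
    {V : Submodule ℝ (Euc n)} {x₀ : Euc n} (hV : ∀ p ∈ 𝔰, ∀ v ∈ V, p.1 v ∈ V)
    (hx₀ : ∀ p ∈ 𝔰, p.1 x₀ + p.2 ∈ V) : V = ⊤ := by
  let M : Submodule ℝ (Euc n × ℝ) := V.comap
    (LinearMap.fst ℝ (Euc n) ℝ - (LinearMap.snd ℝ (Euc n) ℝ).smulRight x₀)
  have hM : ∀ x : Euc n × ℝ, x ∈ M ↔ x.1 - x.2 • x₀ ∈ V := fun x => Iff.rfl
  have hexp : ∀ p ∈ 𝔰, ∀ x ∈ M, NormedSpace.exp (affGen n p) x ∈ M := by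
    intro p hp x hx
    refine exp_apply_mem (Submodule.closed_of_finiteDimensional _) (fun y hy => ?_) hx
    rw [hM] at hy ⊢
    have h := V.add_mem (hV p hp _ hy) (V.smul_mem y.2 (hx₀ p hp))
    rw [map_sub, map_smul, smul_add, ← add_assoc, sub_add_cancel] at h
    simpa [affGen_apply] using h
  have hstab : ∀ g ∈ G, (∀ x ∈ M, affRep n g x ∈ M) ∧ ∀ x ∈ M, affRep n g⁻¹ x ∈ M := by
    intro g hg
    rw [hS.eq_closure] at hg
    induction hg using Subgroup.closure_induction with
    | mem g hg =>
      obtain ⟨p, hp, hg⟩ := hg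
      refine ⟨by rw [hg]; exact hexp p hp, ?_⟩
      have hinv : affRep n g⁻¹ = NormedSpace.exp (affGen n (-p)) := by
        obtain ⟨k, hk⟩ := hS.exists_exp _ (𝔰.neg_mem hp)
        have : k = g⁻¹ := by
          refine eq_inv_of_mul_eq_one_left (affRep_injective n ?_)
          rw [map_mul, hk, hg, map_neg, ← clm_exp_add (by simp), neg_add_cancel,
            NormedSpace.exp_zero, map_one]
        rw [← this, hk]
      rw [hinv]
      exact hexp _ (𝔰.neg_mem hp)
    | one => simp
    | mul g k _ _ hg hk =>
      refine ⟨fun x hx => ?_, fun x hx => ?_⟩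
      · rw [map_mul]; exact hg.1 _ (hk.1 x hx)
      · rw [mul_inv_rev, map_mul]; exact hk.2 _ (hg.2 x hx)
    | inv g _ hg => exact ⟨hg.2, by simpa using hg.1⟩
  rw [Submodule.eq_top_iff']
  intro v
  obtain ⟨g, hg, hgv⟩ := htrans x₀ (x₀ + v)
  have h1 := (hstab g hg).1 (x₀, 1) (by simp [hM])
  rw [hM, affRep_apply] at h1
  simp only [one_smul] at h1
  rw [← affEquiv_apply, hgv] at h1
  simpa using h1

/-- The algebra of a group conjugated by the translation `x ↦ x + q`. -/
noncomputable def translateAlgebra {n : ℕ} (q : Euc n)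
    (𝔰 : Submodule ℝ ((Euc n →L[ℝ] Euc n) × Euc n)) :
    Submodule ℝ ((Euc n →L[ℝ] Euc n) × Euc n) :=
  𝔰.map (LinearMap.prod (LinearMap.fst ℝ _ _) (LinearMap.snd ℝ _ _ -
    (ContinuousLinearMap.apply ℝ (Euc n) q).toLinearMap ∘ₗ LinearMap.fst ℝ _ _))

theorem mem_translateAlgebra {n : ℕ} {q : Euc n}
    {𝔰 : Submodule ℝ ((Euc n →L[ℝ] Euc n) × Euc n)} {p : (Euc n →L[ℝ] Euc n) × Euc n} :
    p ∈ translateAlgebra q 𝔰 ↔ (p.1, p.2 + p.1 q) ∈ 𝔰 := by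
  constructor
  · rintro ⟨r, hr, rfl⟩
    simpa using hr
  · intro h
    exact ⟨_, h, by simp⟩

theorem IsSimLieAlgebra.translate {n : ℕ}
    {𝔰 : Submodule ℝ ((Euc n →L[ℝ] Euc n) × Euc n)} {G : Subgroup (AffGroup n)}
    (hS : IsSimLieAlgebra 𝔰 G) (q : Euc n) {c : AffGroup n} (hc : ∀ x, c x = x + q) :
    IsSimLieAlgebra (translateAlgebra q 𝔰) (G.map (MulAut.conj c).toMonoidHom) := by
  have hcl : ∀ x, c.linear x = x := fun x => by
    have := affEquiv_apply c x
    rw [hc x, hc 0] at this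
    simpa using this.symm
  have hconj : ∀ p, affRep n c * affGen n (p.1, p.2 + p.1 q) * affRep n c⁻¹ = affGen n p := by
    intro p
    have : affRep n c * affGen n (p.1, p.2 + p.1 q) = affGen n p * affRep n c := by
      refine ContinuousLinearMap.ext fun x => Prod.ext ?_ ?_
      · simp [affRep_apply, affGen_apply, hcl, hc]
        abel
      · simp [affRep_apply, affGen_apply]
    rw [this, mul_assoc, ← map_mul, mul_inv_cancel, map_one, mul_one]
  have hexp : ∀ p, NormedSpace.exp (affGen n p) =
      affRep n c * NormedSpace.exp (affGen n (p.1, p.2 + p.1 q)) * affRep n c⁻¹ := by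
    intro p
    rw [← hconj p, exp_conj] <;> rw [← map_mul] <;> simp
  refine ⟨fun p hp r hr => ?_, fun p hp => ?_, fun p hp => ?_, ?_⟩
  · rw [mem_translateAlgebra] at hp hr ⊢
    have := hS.bracket_mem _ hp _ hr
    convert this using 2
    simp
    abel
  · exact hS.conformal (p.1, p.2 + p.1 q) (mem_translateAlgebra.1 hp)
  · obtain ⟨g, hg⟩ := hS.exists_exp _ (mem_translateAlgebra.1 hp)
    exact ⟨c * g * c⁻¹, by rw [map_mul, map_mul, hg, hexp p]⟩
  · rw [hS.eq_closure, MonoidHom.map_closure]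
    congr 1
    ext g
    constructor
    · rintro ⟨k, ⟨p, hp, hk⟩, rfl⟩
      refine ⟨(p.1, p.2 - p.1 q), mem_translateAlgebra.2 (by simpa using hp), ?_⟩
      rw [hexp]
      simp [hk]
    · rintro ⟨p, hp, hg⟩
      refine ⟨c⁻¹ * g * c, ⟨_, mem_translateAlgebra.1 hp, ?_⟩, by simp [mul_assoc]⟩
      rw [map_mul, map_mul, hg, hexp, ← mul_assoc, ← mul_assoc, ← map_mul, inv_mul_cancel, map_one,
        one_mul, mul_assoc, ← map_mul, inv_mul_cancel, map_one, mul_one]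

/-! ### The Hilbert–Schmidt inner product on operators -/

section HilbertSchmidt

variable {E : Type*} [NormedAddCommGroup E] [InnerProductSpace ℝ E] [FiniteDimensional ℝ E]

variable (E) in
/-- The operator `B` as the family of the vectors `B eₖ`. The inner product of these families is
the Hilbert–Schmidt inner product. -/
noncomputable def hsFamily :
    (E →L[ℝ] E) →ₗ[ℝ] PiLp 2 (fun _ : Fin (Module.finrank ℝ E) => E) where
  toFun B := WithLp.toLp 2 fun k => B (stdOrthonormalBasis ℝ E k)
  map_add' _ _ := rfl
  map_smul' _ _ := rfl

theorem hsFamily_injective : Function.Injective (hsFamily E) := by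
  intro B C h
  have hk : ∀ k, B (stdOrthonormalBasis ℝ E k) = C (stdOrthonormalBasis ℝ E k) := fun k =>
    congrArg (fun v : PiLp 2 (fun _ : Fin (Module.finrank ℝ E) => E) => v k) h
  have : (B : E →ₗ[ℝ] E) = C :=
    (stdOrthonormalBasis ℝ E).toBasis.ext fun k => by simpa using hk k
  exact ContinuousLinearMap.coe_injective this

theorem inner_hsFamily (B C : E →L[ℝ] E) :
    ⟪hsFamily E B, hsFamily E C⟫_ℝ =
      LinearMap.trace ℝ E ((ContinuousLinearMap.adjoint B * C : E →L[ℝ] E) : E →ₗ[ℝ] E) := by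
  rw [LinearMap.trace_eq_sum_inner _ (stdOrthonormalBasis ℝ E), PiLp.inner_apply]
  refine Finset.sum_congr rfl fun k _ => ?_
  change _ = ⟪_, (ContinuousLinearMap.adjoint B) (C _)⟫_ℝ
  rw [ContinuousLinearMap.adjoint_inner_right]
  rfl

theorem inner_hsFamily_commutator {A : E →L[ℝ] E} (hA : IsConformalOp A) (B C : E →L[ℝ] E) :
    ⟪hsFamily E (A * B - B * A), hsFamily E C⟫_ℝ =
      -⟪hsFamily E B, hsFamily E (A * C - C * A)⟫_ℝ := by
  obtain ⟨s, hs⟩ := hA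
  have hadj : star A = (2 * s) • 1 - A := by
    rw [ContinuousLinearMap.star_eq_adjoint]
    symm
    rw [ContinuousLinearMap.eq_adjoint_iff]
    intro x y
    have := hs y x
    rw [real_inner_comm, real_inner_comm x y] at this
    rw [sub_apply, inner_sub_left, this]
    simp [inner_smul_left, real_inner_comm y (A x)]
  rw [inner_hsFamily, inner_hsFamily, ← sub_eq_zero, sub_neg_eq_add, ← map_add,
    ← ContinuousLinearMap.star_eq_adjoint, ← ContinuousLinearMap.star_eq_adjoint,
    star_sub, star_mul, star_mul, hadj]
  have : ((((star B * ((2 * s) • 1 - A) - ((2 * s) • 1 - A) * star B) * C : E →L[ℝ] E) :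
        E →ₗ[ℝ] E) + ((star B * (A * C - C * A) : E →L[ℝ] E) : E →ₗ[ℝ] E)) =
      (A : E →ₗ[ℝ] E) * ((star B * C : E →L[ℝ] E) : E →ₗ[ℝ] E) -
      ((star B * C : E →L[ℝ] E) : E →ₗ[ℝ] E) * (A : E →ₗ[ℝ] E) := by
    rw [← ContinuousLinearMap.toLinearMap_add, ← ContinuousLinearMap.toLinearMap_mul,
      ← ContinuousLinearMap.toLinearMap_mul, ← ContinuousLinearMap.toLinearMap_sub]
    congr 1
    rw [mul_sub, sub_mul ((2 * s) • (1 : E →L[ℝ] E)), smul_mul_assoc, mul_smul_comm, one_mul,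
      mul_one]
    noncomm_ring
  rw [this, map_sub, LinearMap.trace_mul_comm, sub_self]

/-- In a Lie algebra of conformal operators, a subspace containing all commutators has a central
complement. -/
theorem exists_central_complement {𝔩 𝔥 : Submodule ℝ (E →L[ℝ] E)}
    (hconf : ∀ B ∈ 𝔩, IsConformalOp B) (h𝔥 : 𝔥 ≤ 𝔩)
    (hcomm : ∀ B ∈ 𝔩, ∀ C ∈ 𝔩, B * C - C * B ∈ 𝔥) :
    ∃ 𝔲 ≤ 𝔩, (∀ B ∈ 𝔲, B ∈ 𝔥 → B = 0) ∧ (∀ B ∈ 𝔩, ∃ A ∈ 𝔥, ∃ C ∈ 𝔲, B = C + A) ∧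
      ∀ B ∈ 𝔩, ∀ C ∈ 𝔲, B * C = C * B := by
  have hzero : ∀ B, ⟪hsFamily E B, hsFamily E B⟫_ℝ = 0 → B = 0 := fun B hB =>
    hsFamily_injective (by rw [inner_self_eq_zero.1 hB, map_zero])
  have hmem : ∀ B, B ∈ ((𝔥.map (hsFamily E))ᗮ).comap (hsFamily E) ↔
      ∀ A ∈ 𝔥, ⟪hsFamily E B, hsFamily E A⟫_ℝ = 0 := by
    intro B
    rw [Submodule.mem_comap, Submodule.mem_orthogonal']
    exact ⟨fun h A hA => h _ ⟨A, hA, rfl⟩, by rintro h _ ⟨A, hA, rfl⟩; exact h A hA⟩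
  refine ⟨𝔩 ⊓ ((𝔥.map (hsFamily E))ᗮ).comap (hsFamily E), inf_le_left, ?_, ?_, ?_⟩
  · rintro B ⟨-, hB⟩ hB'
    exact hzero B ((hmem B).1 hB B hB')
  · intro B hB
    obtain ⟨A, hA, hAB⟩ := (𝔥.map (hsFamily E)).starProjection_apply_mem (hsFamily E B)
    refine ⟨A, hA, B - A, ⟨𝔩.sub_mem hB (h𝔥 hA), ?_⟩, by simp⟩
    change hsFamily E (B - A) ∈ (𝔥.map (hsFamily E))ᗮ
    rw [map_sub, hAB]
    exact Submodule.sub_starProjection_mem_orthogonal _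
  · rintro B hB C ⟨hC, hC'⟩
    refine sub_eq_zero.1 (hzero _ ?_)
    rw [inner_hsFamily_commutator (hconf B hB),
      (hmem C).1 hC' _ (hcomm _ hB _ (h𝔥 (hcomm _ hB _ hC))), neg_zero]

/-! ### The Casimir operator -/

theorem casimir_identity {F ι : Type*} [AddCommGroup F] [Module ℝ F] [Fintype ι]
    {B : ι → Module.End ℝ F} {b : ι → F} {C : Module.End ℝ F} {c : F} {r : ι → ι → ℝ}
    (hr : ∀ i j, r i j = -r j i) (hB : ∀ i x, C (B i x) - B i (C x) = ∑ j, r i j • B j x)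
    (hb : ∀ i, C (b i) - B i c = ∑ j, r i j • b j) :
    C (∑ i, B i (b i)) = ∑ i, B i (B i c) := by
  have h1 : ∀ i, C (B i (b i)) =
      B i (B i c) + (∑ j, r i j • B i (b j) + ∑ j, r i j • B j (b i)) := by
    intro i
    have h2 : C (b i) = B i c + ∑ j, r i j • b j := by rw [← hb i]; abel
    rw [← hB i (b i), h2, map_add, map_sum]
    simp only [map_smul]
    abel
  have h3 : ∑ i, ∑ j, r i j • B j (b i) = -∑ i, ∑ j, r i j • B i (b j) := by
    rw [Finset.sum_comm, ← Finset.sum_neg_distrib]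
    refine Finset.sum_congr rfl fun i _ => ?_
    rw [← Finset.sum_neg_distrib]
    refine Finset.sum_congr rfl fun j _ => ?_
    rw [hr j i, neg_smul]
  rw [map_sum, Finset.sum_congr rfl fun i _ => h1 i, Finset.sum_add_distrib,
    Finset.sum_add_distrib, h3]
  simp

/-- A cocycle `B ↦ b` on a Lie algebra of skew operators takes, after subtraction of a coboundary
`B ↦ B p`, only values killed by the algebra. -/
theorem exists_cocycle_normalization {𝔨 : Submodule ℝ ((E →L[ℝ] E) × E)}
    (hbr : ∀ X ∈ 𝔨, ∀ Y ∈ 𝔨, (X.1 * Y.1 - Y.1 * X.1, X.1 Y.2 - Y.1 X.2) ∈ 𝔨)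
    (hskew : ∀ X ∈ 𝔨, IsSkewOp X.1)
    (hinj : ∀ X ∈ 𝔨, X.1 = 0 → X = 0) :
    ∃ p, ∀ X ∈ 𝔨, ∀ Y ∈ 𝔨, X.1 (Y.2 - Y.1 p) = 0 := by
  let τ := hsFamily E ∘ₗ LinearMap.fst ℝ (E →L[ℝ] E) (E)
  have hτ : ∀ X, τ X = hsFamily E X.1 := fun _ => rfl
  let e := stdOrthonormalBasis ℝ (𝔨.map τ)
  have hlift : ∀ i, ∃ X ∈ 𝔨, τ X = e i := fun i => (e i).2
  choose Z hZ𝔨 hZ using hlift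
  have hexpand : ∀ X ∈ 𝔨, X = ∑ i, ⟪hsFamily E (Z i).1, hsFamily E X.1⟫_ℝ • Z i := by
    intro X hX
    rw [← sub_eq_zero]
    refine hinj _ (𝔨.sub_mem hX (𝔨.sum_mem fun i _ => 𝔨.smul_mem _ (hZ𝔨 i))) ?_
    apply hsFamily_injective
    rw [← hτ, map_zero, map_sub, map_sum, sub_eq_zero]
    have h1 := congrArg (Submodule.subtype _) (e.sum_repr' ⟨τ X, X, hX, rfl⟩)
    rw [map_sum] at h1
    simp only [map_smul, hZ, ← hτ]
    exact h1.symm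
  set y := ∑ i, (Z i).1 (Z i).2
  let Ω : Module.End ℝ (E) := ∑ i, ((Z i).1 : E →ₗ[ℝ] E) * ((Z i).1 : E →ₗ[ℝ] E)
  have hΩ : ∀ x, Ω x = ∑ i, (Z i).1 ((Z i).1 x) := fun x => by simp [Ω]
  have hker : ∀ x, Ω x = 0 → ∀ i, (Z i).1 x = 0 := by
    intro x hx
    have h1 : ⟪x, Ω x⟫_ℝ = -∑ i, ‖(Z i).1 x‖ ^ 2 := by
      rw [hΩ, inner_sum, ← Finset.sum_neg_distrib]
      refine Finset.sum_congr rfl fun i _ => ?_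
      rw [← real_inner_self_eq_norm_sq, hskew _ (hZ𝔨 i), neg_neg]
    rw [hx, inner_zero_right, zero_eq_neg,
      Finset.sum_eq_zero_iff_of_nonneg fun i _ => by positivity] at h1
    intro i
    simpa using h1 i (Finset.mem_univ i)
  have hsymm : Ω.adjoint = Ω := by
    symm
    rw [LinearMap.eq_adjoint_iff]
    intro x z
    simp only [hΩ, sum_inner, inner_sum]
    refine Finset.sum_congr rfl fun i _ => ?_
    rw [hskew _ (hZ𝔨 i),
      hskew _ (hZ𝔨 i), neg_neg]
  obtain ⟨p, hp⟩ : y ∈ LinearMap.range Ω := by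
    rw [← hsymm, ← LinearMap.orthogonal_ker, Submodule.mem_orthogonal]
    intro x hx
    rw [inner_sum]
    refine Finset.sum_eq_zero fun i _ => ?_
    rw [← neg_eq_zero, ← hskew _ (hZ𝔨 i), hker x hx i,
      inner_zero_left]
  refine ⟨p, fun X hX Y hY => ?_⟩
  have hY' : ∀ i, (Z i).1 (Y.2 - Y.1 p) = 0 := by
    apply hker
    rw [hΩ]
    have hcomm : ∀ i, (Y.1 * (Z i).1 - (Z i).1 * Y.1, Y.1 (Z i).2 - (Z i).1 Y.2) =
        ∑ j, ⟪hsFamily E (Z j).1, hsFamily E (Y.1 * (Z i).1 - (Z i).1 * Y.1)⟫_ℝ • Z j := fun i =>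
      hexpand _ (hbr Y hY _ (hZ𝔨 i))
    have hB : ∀ i x, Y.1 ((Z i).1 x) - (Z i).1 (Y.1 x) =
        ∑ j, ⟪hsFamily E (Z j).1, hsFamily E (Y.1 * (Z i).1 - (Z i).1 * Y.1)⟫_ℝ • (Z j).1 x := by
      intro i x
      have := congrArg (fun q : (E →L[ℝ] E) × E => q.1 x) (hcomm i)
      simpa [Prod.fst_sum] using this
    have hcas := casimir_identity (B := fun i => ((Z i).1 : E →ₗ[ℝ] E))
      (b := fun i => (Z i).2 - (Z i).1 p) (C := (Y.1 : E →ₗ[ℝ] E)) (c := Y.2 - Y.1 p)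
      (r := fun i j => ⟪hsFamily E (Z j).1, hsFamily E (Y.1 * (Z i).1 - (Z i).1 * Y.1)⟫_ℝ)
      (fun i j => by
        rw [real_inner_comm, inner_hsFamily_commutator (hskew Y hY).isConformalOp])
      hB
      (fun i => by
        have h1 := congrArg Prod.snd (hcomm i)
        have h2 := hB i p
        simp only [Prod.snd_sum, Prod.smul_snd] at h1
        simp only [ContinuousLinearMap.coe_coe, smul_sub, Finset.sum_sub_distrib]
        rw [← h1, ← h2, map_sub, map_sub]
        abel)
    simp only [ContinuousLinearMap.coe_coe] at hcas
    rw [← hcas]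
    have : ∑ i, (Z i).1 ((Z i).2 - (Z i).1 p) = 0 := by
      simp only [map_sub, Finset.sum_sub_distrib]
      rw [← hΩ, hp, sub_self]
    rw [this, map_zero]
  have := congrArg (fun q : (E →L[ℝ] E) × E => q.1 (Y.2 - Y.1 p)) (hexpand X hX)
  simpa [Prod.fst_sum, hY', -map_sub] using this

end HilbertSchmidt

/-! ### Skew and conformal operators -/

section Operators

variable {E : Type*} [NormedAddCommGroup E] [InnerProductSpace ℝ E]

variable (E) in
/-- The space of skew operators. -/
def skewOps : Submodule ℝ (E →L[ℝ] E) where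
  carrier := {A | IsSkewOp A}
  zero_mem' := fun x y => by simp
  add_mem' := fun {A B} hA hB x y => by
    simp only [add_apply, inner_add_left, inner_add_right, hA x y, hB x y]
    ring
  smul_mem' := fun r _ hA => hA.smul r

theorem IsConformalOp.commutator_isSkewOp {A B : E →L[ℝ] E} (hA : IsConformalOp A)
    (hB : IsConformalOp B) : IsSkewOp (A * B - B * A) := by
  obtain ⟨s, hs⟩ := hA
  obtain ⟨t, ht⟩ := hB
  intro x y
  change ⟪A (B x) - B (A x), y⟫_ℝ = -⟪x, A (B y) - B (A y)⟫_ℝ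
  rw [inner_sub_left, inner_sub_right, hs, ht, ht (A x), hs x (B y), ht x (A y), hs x y]
  ring

theorem IsConformalOp.apply_mem_orthogonal {A : E →L[ℝ] E} (hA : IsConformalOp A)
    {V : Submodule ℝ E} (hV : ∀ v ∈ V, A v ∈ V) {x : E} (hx : x ∈ Vᗮ) : A x ∈ Vᗮ := by
  obtain ⟨s, hs⟩ := hA
  rw [Submodule.mem_orthogonal'] at hx ⊢
  intro v hv
  rw [hs, hx v hv, hx _ (hV v hv)]
  ring

theorem IsConformalOp.exists_smul {A : E →L[ℝ] E} (hA : IsConformalOp A) (h : ¬IsSkewOp A) :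
    ∃ r : ℝ, ∀ x y, ⟪(r • A) x, y⟫_ℝ = 2 * ⟪x, y⟫_ℝ - ⟪x, (r • A) y⟫_ℝ := by
  obtain ⟨s, hs⟩ := hA
  have hs0 : s ≠ 0 := by
    rintro rfl
    exact h fun x y => by simpa using hs x y
  refine ⟨s⁻¹, fun x y => ?_⟩
  simp only [smul_apply, inner_smul_left, inner_smul_right, hs x y, conj_trivial]
  field_simp

theorem IsConformalOp.exists_sub_smul {A Z : E →L[ℝ] E} (hA : IsConformalOp A)
    (hZ : ∀ x y, ⟪Z x, y⟫_ℝ = 2 * ⟪x, y⟫_ℝ - ⟪x, Z y⟫_ℝ) : ∃ t : ℝ, IsSkewOp (A - t • Z) := by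
  obtain ⟨s, hs⟩ := hA
  refine ⟨s, fun x y => ?_⟩
  simp only [sub_apply, smul_apply, inner_sub_left, inner_sub_right, inner_smul_left,
    inner_smul_right, hs x y, hZ x y, conj_trivial]
  ring

theorem isSkewOp_sub_one {Z : E →L[ℝ] E}
    (hZ : ∀ x y, ⟪Z x, y⟫_ℝ = 2 * ⟪x, y⟫_ℝ - ⟪x, Z y⟫_ℝ) : IsSkewOp (Z - 1) := fun x y => by
  simp only [sub_apply, one_apply_eq_self, inner_sub_left, inner_sub_right, hZ x y]
  ring

theorem injective_of_inner {Z : E →L[ℝ] E}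
    (hZ : ∀ x y, ⟪Z x, y⟫_ℝ = 2 * ⟪x, y⟫_ℝ - ⟪x, Z y⟫_ℝ) : Function.Injective Z := by
  rw [injective_iff_map_eq_zero]
  intro x hx
  have := hZ x x
  rw [hx, inner_zero_left, inner_zero_right, sub_zero] at this
  exact inner_self_eq_zero.1 (by linarith : ⟪x, x⟫_ℝ = 0)

theorem exp_smul_apply_eq [CompleteSpace E] (r : ℝ) (Z : E →L[ℝ] E) (x : E) :
    NormedSpace.exp (r • Z) x = Real.exp r • NormedSpace.exp (r • (Z - 1)) x := by
  have h1 : r • Z = r • (1 : E →L[ℝ] E) + r • (Z - 1) := by rw [← smul_add, add_sub_cancel]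
  have h2 : NormedSpace.exp (r • (1 : E →L[ℝ] E)) = Real.exp r • 1 := by
    have := NormedSpace.algebraMap_exp_comm (𝕂 := ℝ) (𝔸 := E →L[ℝ] E) r
    rw [Algebra.algebraMap_eq_smul_one, Algebra.algebraMap_eq_smul_one, ← Real.exp_eq_exp_ℝ] at this
    exact this.symm
  rw [h1, clm_exp_add (by simp), h2]
  simp

theorem clm_exp_smul_add [CompleteSpace E] (r s : ℝ) (A : E →L[ℝ] E) :
    NormedSpace.exp ((r + s) • A) = NormedSpace.exp (r • A) * NormedSpace.exp (s • A) := by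
  rw [add_smul, clm_exp_add]
  rw [smul_mul_smul_comm, smul_mul_smul_comm, mul_comm r s]

theorem smul_commutator_eq_zero {Z A : E →L[ℝ] E} (h : A * Z = Z * A) (t : ℝ) :
    (t • Z) * A - A * (t • Z) = 0 := by
  rw [smul_mul_assoc, mul_smul_comm, h, sub_self]

theorem mul_exp_comm [CompleteSpace E] {Z A : E →L[ℝ] E} (h : A * Z = Z * A) :
    A * NormedSpace.exp Z = NormedSpace.exp Z * A :=
  ContinuousLinearMap.ext fun x => (exp_apply_intertwine A
    (fun y => congrArg (fun S : E →L[ℝ] E => S y) h.symm) x).symm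

end Operators

/-! ### Assembling the group -/

/-- The group of rotations generated by the exponentials of the elements of `𝔥`. -/
noncomputable def expGroup {n : ℕ} (𝔥 : Submodule ℝ (Euc n →L[ℝ] Euc n)) :
    Subgroup (OrthGroup n) :=
  Subgroup.closure {f | ∃ A ∈ 𝔥, linRep n f = NormedSpace.exp A}

theorem isConnectedLieSubgroup_expGroup {n : ℕ} {𝔥 : Submodule ℝ (Euc n →L[ℝ] Euc n)}
    (hskew : ∀ A ∈ 𝔥, IsSkewOp A) (hbr : ∀ A ∈ 𝔥, ∀ B ∈ 𝔥, A * B - B * A ∈ 𝔥) :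
    IsConnectedLieSubgroup (linRep n) (expGroup 𝔥) :=
  ⟨𝔥, hbr, fun A hA => ⟨expOrth A (hskew A hA), rfl⟩, rfl⟩

theorem expGroup_le_SOGroup {n : ℕ} {𝔥 : Submodule ℝ (Euc n →L[ℝ] Euc n)}
    (hskew : ∀ A ∈ 𝔥, IsSkewOp A) : expGroup 𝔥 ≤ SOGroup n := by
  refine (Subgroup.closure_le _).2 ?_
  rintro f ⟨A, hA, hf⟩
  rw [linRep_injective n (hf.trans (linRep_expOrth A (hskew A hA)).symm)]
  exact expOrth_mem_SOGroup A (hskew A hA)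

theorem expOrth_mem_SOSub {n : ℕ} {W : Submodule ℝ (Euc n)} {A : Euc n →L[ℝ] Euc n}
    (hA : IsSkewOp A) (h : ∀ x ∈ Wᗮ, A x = 0) : expOrth A hA ∈ SOSub W :=
  ⟨expOrth_mem_SOGroup A hA, fun x hx => exp_apply_of_apply_eq_zero (h x hx)⟩

theorem expGroup_le_SOSub {n : ℕ} {W : Submodule ℝ (Euc n)}
    {𝔥 : Submodule ℝ (Euc n →L[ℝ] Euc n)} (hskew : ∀ A ∈ 𝔥, IsSkewOp A)
    (h : ∀ A ∈ 𝔥, ∀ x ∈ Wᗮ, A x = 0) : expGroup 𝔥 ≤ SOSub W := by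
  refine (Subgroup.closure_le _).2 ?_
  rintro f ⟨A, hA, hf⟩
  rw [linRep_injective n (hf.trans (linRep_expOrth A (hskew A hA)).symm)]
  exact expOrth_mem_SOSub (hskew A hA) (h A hA)

/-- An operator commuting with `𝔥` commutes with the group generated by `𝔥`. -/
theorem expGroup_apply_comm {n : ℕ} {𝔥 : Submodule ℝ (Euc n →L[ℝ] Euc n)}
    {T : Euc n →L[ℝ] Euc n} (hT : ∀ A ∈ 𝔥, A * T = T * A) {f : OrthGroup n}
    (hf : f ∈ expGroup 𝔥) : ∀ x, f (T x) = T (f x) := by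
  induction hf using Subgroup.closure_induction with
  | mem f hf =>
    obtain ⟨A, hA, hf⟩ := hf
    intro x
    have hfx : ∀ y, f y = NormedSpace.exp A y := fun y =>
      congrArg (fun S : Euc n →L[ℝ] Euc n => S y) hf
    rw [hfx, hfx]
    exact exp_apply_intertwine T
      (fun y => congrArg (fun S : Euc n →L[ℝ] Euc n => S y) (hT A hA)) x
  | one => exact fun _ => rfl
  | mul f g _ _ hf hg =>
    intro x
    change f (g (T x)) = T (f (g x))
    rw [hg, hf]
  | inv f _ hf =>
    intro x
    change f.symm (T x) = T (f.symm x)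
    rw [LinearIsometryEquiv.symm_apply_eq, hf, LinearIsometryEquiv.apply_symm_apply]

theorem rotHom_apply {n : ℕ} (f : OrthGroup n) (x : Euc n) : rotHom n f x = f x :=
  rfl

theorem exists_mul_of_mem_sup {Γ : Type*} [Group Γ] {A B : Subgroup Γ}
    (h : ∀ a ∈ A, ∀ b ∈ B, a * b = b * a) {g : Γ} (hg : g ∈ A ⊔ B) :
    ∃ a ∈ A, ∃ b ∈ B, g = a * b := by
  rw [Subgroup.sup_eq_closure] at hg
  induction hg using Subgroup.closure_induction with
  | mem g hg =>
    rcases hg with hg | hg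
    · exact ⟨g, hg, 1, one_mem _, by simp⟩
    · exact ⟨1, one_mem _, g, hg, by simp⟩
  | one => exact ⟨1, one_mem _, 1, one_mem _, by simp⟩
  | mul g k _ _ hg hk =>
    obtain ⟨a, ha, b, hb, rfl⟩ := hg
    obtain ⟨a', ha', b', hb', rfl⟩ := hk
    refine ⟨a * a', mul_mem ha ha', b * b', mul_mem hb hb', ?_⟩
    rw [mul_assoc, ← mul_assoc b, ← h a' ha' b hb, mul_assoc, mul_assoc]
  | inv g _ hg =>
    obtain ⟨a, ha, b, hb, rfl⟩ := hg
    exact ⟨a⁻¹, inv_mem ha, b⁻¹, inv_mem hb, by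
      rw [mul_inv_rev, h a⁻¹ (inv_mem ha) b⁻¹ (inv_mem hb)]⟩

theorem conj_mem_translations {n : ℕ} {W : Submodule ℝ (Euc n)} {g τ : AffGroup n}
    (hg : ∀ w ∈ W, g.linear w ∈ W) (hτ : τ ∈ translations W) : g * τ * g⁻¹ ∈ translations W := by
  obtain ⟨w, hw, hτ⟩ := hτ
  refine ⟨g.linear w, hg w hw, fun x => ?_⟩
  change g (τ (g.symm x)) = _
  rw [hτ, affEquiv_apply, map_add]
  conv_rhs => rw [← g.apply_symm_apply x, affEquiv_apply g]
  abel

theorem eq_one_of_mem_translations {n : ℕ} {W : Submodule ℝ (Euc n)} {g : AffGroup n}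
    (hg : g ∈ translations W) (h0 : g 0 = 0) : g = 1 := by
  obtain ⟨w, -, hg⟩ := hg
  rw [hg, zero_add] at h0
  ext1 x
  rw [hg, h0, add_zero]
  rfl

theorem rotHom_mem_of_mem_expGroup {n : ℕ}
    {𝔰 : Submodule ℝ ((Euc n →L[ℝ] Euc n) × Euc n)} {G : Subgroup (AffGroup n)}
    (hS : IsSimLieAlgebra 𝔰 G) {𝔥 : Submodule ℝ (Euc n →L[ℝ] Euc n)}
    (h𝔥 : ∀ A ∈ 𝔥, (A, (0 : Euc n)) ∈ 𝔰) : (expGroup 𝔥).map (rotHom n) ≤ G := by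
  rw [expGroup, MonoidHom.map_closure, Subgroup.closure_le]
  rintro _ ⟨f, ⟨A, hA, hf⟩, rfl⟩
  rw [hS.eq_closure]
  refine Subgroup.subset_closure ⟨_, h𝔥 A hA, affRep_eq_exp (map_zero A) fun x => ?_⟩
  rw [rotHom_apply, add_zero]
  exact congrArg (fun S : Euc n →L[ℝ] Euc n => S x) hf

/-- If every vector field of `𝔰` is the sum of commuting fields from `P` and `𝔥` up to translations
along `V`, then `G` is generated by `P`, `exp 𝔥` and the translations along `V`. -/
theorem IsSimLieAlgebra.eq_sup {n : ℕ}
    {𝔰 : Submodule ℝ ((Euc n →L[ℝ] Euc n) × Euc n)} {G : Subgroup (AffGroup n)}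
    (hS : IsSimLieAlgebra 𝔰 G) {𝔥 : Submodule ℝ (Euc n →L[ℝ] Euc n)}
    (hskew : ∀ A ∈ 𝔥, IsSkewOp A) (h𝔥 : ∀ A ∈ 𝔥, (A, (0 : Euc n)) ∈ 𝔰)
    {V : Submodule ℝ (Euc n)} (hV : ∀ v ∈ V, ((0 : Euc n →L[ℝ] Euc n), v) ∈ 𝔰)
    (hinv : ∀ p ∈ 𝔰, ∀ v ∈ V, p.1 v ∈ V) {P : Subgroup (AffGroup n)}
    (hP : ∀ k ∈ P, ∃ p ∈ 𝔰, affRep n k = NormedSpace.exp (affGen n p))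
    (hdec : ∀ p ∈ 𝔰, ∃ q, ∃ A ∈ 𝔥, (∃ k ∈ P, affRep n k = NormedSpace.exp (affGen n q)) ∧
      p.1 = q.1 + A ∧ p.2 - q.2 ∈ V ∧ q.1 * A - A * q.1 = 0 ∧ A q.2 = 0) :
    G = ((expGroup 𝔥).map (rotHom n) ⊔ P) ⊔ translations V := by
  apply le_antisymm
  · conv_lhs => rw [hS.eq_closure]
    rw [Subgroup.closure_le]
    rintro g ⟨p, hp, hg⟩
    obtain ⟨q, A, hA, ⟨k, hkP, hk⟩, h1, h2, hcomm, hAq⟩ := hdec p hp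
    have hrot : affRep n (rotHom n (expOrth A (hskew A hA))) =
        NormedSpace.exp (affGen n (A, 0)) :=
      affRep_eq_exp (map_zero A) fun x => by rw [rotHom_apply, add_zero, expOrth_apply]
    have hk' : affRep n (k * rotHom n (expOrth A (hskew A hA))) =
        NormedSpace.exp (affGen n (p.1, q.2)) := by
      have hz : affGen n q * affGen n (A, 0) = affGen n (A, 0) * affGen n q := by
        rw [← sub_eq_zero, affGen_mul_sub]
        have : (q.1 * A - A * q.1, q.1 0 - A q.2) = ((0 : Euc n →L[ℝ] Euc n), (0 : Euc n)) := by
          rw [hcomm, hAq, map_zero, sub_zero]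
        exact (congrArg (affGen n) this).trans (map_zero _)
      rw [map_mul, hk, hrot, ← clm_exp_add hz, ← map_add, h1]
      congr 2
      exact Prod.ext rfl (add_zero _)
    have hmem := mul_inv_mem_translations (V := V) hg hk' (hinv p hp) h2
    rw [SetLike.mem_coe, ← inv_mul_cancel_right g (k * rotHom n (expOrth A (hskew A hA)))]
    refine mul_mem (Subgroup.mem_sup_right hmem) (Subgroup.mem_sup_left (mul_mem
      (Subgroup.mem_sup_right hkP) (Subgroup.mem_sup_left ⟨_, Subgroup.subset_closure ?_, rfl⟩)))
    exact ⟨A, hA, linRep_expOrth A (hskew A hA)⟩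
  · refine sup_le (sup_le (rotHom_mem_of_mem_expGroup hS h𝔥) fun k hk => ?_) ?_
    · obtain ⟨p, hp, hk⟩ := hP k hk
      rw [hS.eq_closure]
      exact Subgroup.subset_closure ⟨p, hp, hk⟩
    · rintro τ ⟨v, hv, hτ⟩
      rw [hS.eq_closure]
      refine Subgroup.subset_closure ⟨_, hV v hv, affRep_eq_exp rfl fun x => ?_⟩
      rw [hτ, NormedSpace.exp_zero]
      rfl

/-! ### The translation part of the Lie algebra -/

/-- The vectors of the translations in the algebra `𝔰`. -/
noncomputable def transPart {n : ℕ} (𝔰 : Submodule ℝ ((Euc n →L[ℝ] Euc n) × Euc n)) :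
    Submodule ℝ (Euc n) :=
  𝔰.comap (LinearMap.inr ℝ (Euc n →L[ℝ] Euc n) (Euc n))

theorem mem_transPart {n : ℕ} {𝔰 : Submodule ℝ ((Euc n →L[ℝ] Euc n) × Euc n)} {v : Euc n} :
    v ∈ transPart 𝔰 ↔ ((0 : Euc n →L[ℝ] Euc n), v) ∈ 𝔰 :=
  Iff.rfl

theorem transPart_translateAlgebra {n : ℕ} (𝔰 : Submodule ℝ ((Euc n →L[ℝ] Euc n) × Euc n))
    (q : Euc n) : transPart (translateAlgebra q 𝔰) = transPart 𝔰 := by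
  ext v
  rw [mem_transPart, mem_translateAlgebra, mem_transPart]
  simp

theorem eq_zero_of_mem_orthogonal {n : ℕ} {V : Submodule ℝ (Euc n)} {v : Euc n} (h : v ∈ V)
    (h' : v ∈ Vᗮ) : v = 0 :=
  inner_self_eq_zero.1 (Submodule.mem_orthogonal V v |>.1 h' v h)

namespace IsSimLieAlgebra

variable {n : ℕ} {𝔰 : Submodule ℝ ((Euc n →L[ℝ] Euc n) × Euc n)} {G : Subgroup (AffGroup n)}

theorem apply_mem_transPart (hS : IsSimLieAlgebra 𝔰 G) {p : (Euc n →L[ℝ] Euc n) × Euc n}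
    (hp : p ∈ 𝔰) {v : Euc n} (hv : v ∈ transPart 𝔰) : p.1 v ∈ transPart 𝔰 := by
  have := hS.bracket_mem p hp _ (mem_transPart.1 hv)
  simpa [mem_transPart] using this

theorem apply_mem_orthogonal (hS : IsSimLieAlgebra 𝔰 G) {p : (Euc n →L[ℝ] Euc n) × Euc n}
    (hp : p ∈ 𝔰) {v : Euc n} (hv : v ∈ (transPart 𝔰)ᗮ) : p.1 v ∈ (transPart 𝔰)ᗮ :=
  (hS.conformal p hp).apply_mem_orthogonal (fun _ hw => hS.apply_mem_transPart hp hw) hv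

theorem exists_orthogonal_rep {p : (Euc n →L[ℝ] Euc n) × Euc n} (hp : p ∈ 𝔰) :
    ∃ b ∈ (transPart 𝔰)ᗮ, (p.1, b) ∈ 𝔰 ∧ p.2 - b ∈ transPart 𝔰 := by
  have h1 : (transPart 𝔰).starProjection p.2 ∈ transPart 𝔰 :=
    Submodule.starProjection_apply_mem _ _
  refine ⟨p.2 - (transPart 𝔰).starProjection p.2,
    Submodule.sub_starProjection_mem_orthogonal _, ?_, by simp⟩
  have := 𝔰.sub_mem hp (mem_transPart.1 h1)
  simpa [Prod.sub_def] using this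

theorem eq_zero_of_mem_orthogonal {b : Euc n} (h : ((0 : Euc n →L[ℝ] Euc n), b) ∈ 𝔰)
    (hb : b ∈ (transPart 𝔰)ᗮ) : b = 0 :=
  _root_.eq_zero_of_mem_orthogonal (mem_transPart.2 h) hb

theorem commutator_mem_map_fst (hS : IsSimLieAlgebra 𝔰 G) {B C : Euc n →L[ℝ] Euc n}
    (hB : B ∈ 𝔰.map (LinearMap.fst ℝ _ _)) (hC : C ∈ 𝔰.map (LinearMap.fst ℝ _ _)) :
    B * C - C * B ∈ 𝔰.map (LinearMap.fst ℝ _ _) := by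
  obtain ⟨p, hp, rfl⟩ := hB
  obtain ⟨q, hq, rfl⟩ := hC
  exact ⟨_, hS.bracket_mem p hp q hq, rfl⟩

theorem conformal_of_mem_map_fst (hS : IsSimLieAlgebra 𝔰 G) {B : Euc n →L[ℝ] Euc n}
    (hB : B ∈ 𝔰.map (LinearMap.fst ℝ _ _)) : IsConformalOp B := by
  obtain ⟨p, hp, rfl⟩ := hB
  exact hS.conformal p hp

/-! ### Groups containing proper similarities -/

/-- If a linear part `Z` is central and has scale one, then a transitive group contains all the
translations. -/
theorem transPart_eq_top (hS : IsSimLieAlgebra 𝔰 G)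
    (htrans : ∀ x y : Euc n, ∃ g ∈ G, g x = y) {Z : Euc n →L[ℝ] Euc n}
    (hZ : Z ∈ 𝔰.map (LinearMap.fst ℝ _ _))
    (hZ1 : ∀ x y, ⟪Z x, y⟫_ℝ = 2 * ⟪x, y⟫_ℝ - ⟪x, Z y⟫_ℝ)
    (hcomm : ∀ p ∈ 𝔰, Z * p.1 - p.1 * Z = 0) : transPart 𝔰 = ⊤ := by
  obtain ⟨q, hq, rfl⟩ := hZ
  obtain ⟨z, hz, hqz, -⟩ := exists_orthogonal_rep hq
  have hinj := injective_of_inner hZ1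
  obtain ⟨x, hx⟩ := (LinearMap.injective_iff_surjective (f := (q.1 : Euc n →ₗ[ℝ] Euc n))).1 hinj z
  refine hS.eq_top_of_tangent htrans (x₀ := -x) (fun p hp v hv => hS.apply_mem_transPart hp hv)
    fun p hp => ?_
  obtain ⟨b, hb, hpb, hbV⟩ := exists_orthogonal_rep hp
  have h1 := hS.bracket_mem _ hqz _ hpb
  have h2 : q.1 b - p.1 z = 0 := by
    refine eq_zero_of_mem_orthogonal (𝔰 := 𝔰) ?_ (Submodule.sub_mem _
      (hS.apply_mem_orthogonal hqz hb) (hS.apply_mem_orthogonal hpb hz))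
    have h3 : q.1 * p.1 - p.1 * q.1 = 0 := hcomm p hp
    rwa [h3] at h1
  have h4 : q.1 (p.1 x) = p.1 (q.1 x) :=
    sub_eq_zero.1 (congrArg (fun S : Euc n →L[ℝ] Euc n => S x) (hcomm p hp))
  have h5 : b = p.1 x := by
    apply hinj
    change q.1 b = q.1 (p.1 x)
    rw [h4, sub_eq_zero.1 h2, ← hx]
    rfl
  rw [map_neg, ← h5, neg_add_eq_sub]
  exact hbV

/-- The one-parameter group `a ↦ exp (log a • A)` of rotations. -/
noncomputable def rotationFlow (A : Euc n →L[ℝ] Euc n) (hA : IsSkewOp A) :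
    PosReal →* SOGroup n where
  toFun a := ⟨expOrth (Real.log a • A) (hA.smul _), expOrth_mem_SOGroup _ _⟩
  map_one' := by
    refine Subtype.ext (linRep_injective n ?_)
    refine ContinuousLinearMap.ext fun x => exp_apply_of_apply_eq_zero ?_
    change Real.log (1 : ℝ) • A x = 0
    rw [Real.log_one, zero_smul]
  map_mul' a b := by
    refine Subtype.ext (linRep_injective n ?_)
    change NormedSpace.exp (Real.log ((a : ℝ) * (b : ℝ)) • A) =
      NormedSpace.exp (Real.log a • A) * NormedSpace.exp (Real.log b • A)
    rw [Real.log_mul a.2.ne' b.2.ne']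
    exact clm_exp_smul_add _ _ A

theorem continuous_rotationFlow (A : Euc n →L[ℝ] Euc n) (hA : IsSkewOp A) :
    Continuous fun a => linRep n (rotationFlow A hA a) := by
  change Continuous fun a : PosReal => NormedSpace.exp (Real.log a • A)
  refine continuous_clm_exp.comp ?_
  have : Continuous fun a : PosReal => Real.log a :=
    continuous_subtype_val.log fun a => a.2.ne'
  fun_prop

theorem isType3 (hS : IsSimLieAlgebra 𝔰 G) (htrans : ∀ x y : Euc n, ∃ g ∈ G, g x = y)
    (hns : ∃ p ∈ 𝔰, ¬IsSkewOp p.1) : IsType3 G := by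
  set 𝔩 := 𝔰.map (LinearMap.fst ℝ (Euc n →L[ℝ] Euc n) (Euc n))
  obtain ⟨𝔲, h𝔲𝔩, -, hdec, hcomm⟩ := exists_central_complement (𝔩 := 𝔩) (𝔥 := 𝔩 ⊓ skewOps (Euc n))
    (fun B hB => hS.conformal_of_mem_map_fst hB) inf_le_left
    (fun B hB C hC => ⟨hS.commutator_mem_map_fst hB hC,
      (hS.conformal_of_mem_map_fst hB).commutator_isSkewOp (hS.conformal_of_mem_map_fst hC)⟩)
  obtain ⟨Z, hZ𝔲, hZ⟩ : ∃ Z ∈ 𝔲, ∀ x y, ⟪Z x, y⟫_ℝ = 2 * ⟪x, y⟫_ℝ - ⟪x, Z y⟫_ℝ := by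
    obtain ⟨p, hp, hpns⟩ := hns
    obtain ⟨A, hA, C, hC, hpAC⟩ := hdec p.1 ⟨p, hp, rfl⟩
    have hCns : ¬IsSkewOp C := fun h => hpns (by
      rw [hpAC]
      exact (skewOps (Euc n)).add_mem h hA.2)
    obtain ⟨r, hr⟩ := (hS.conformal_of_mem_map_fst (h𝔲𝔩 hC)).exists_smul hCns
    exact ⟨r • C, 𝔲.smul_mem r hC, hr⟩
  have hV : transPart 𝔰 = ⊤ := hS.transPart_eq_top htrans (h𝔲𝔩 hZ𝔲) hZ fun p hp =>
    sub_eq_zero.2 (hcomm p.1 ⟨p, hp, rfl⟩ Z hZ𝔲).symm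
  have hmem : ∀ B ∈ 𝔩, ∀ b, (B, b) ∈ 𝔰 := by
    rintro _ ⟨p, hp, rfl⟩ b
    have : b - p.2 ∈ transPart 𝔰 := hV ▸ Submodule.mem_top
    have := 𝔰.add_mem hp (mem_transPart.1 this)
    simpa [Prod.add_def] using this
  have hskew : ∀ A ∈ 𝔩 ⊓ skewOps (Euc n), IsSkewOp A := fun A hA => hA.2
  set Φ := rotationFlow (Z - 1) (isSkewOp_sub_one hZ)
  have hscrew : ∀ (g : AffGroup n) (a : PosReal), (∀ x, g x = (a : ℝ) • (Φ a : OrthGroup n) x) →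
      ∀ x, g x = NormedSpace.exp (Real.log a • Z) x := by
    intro g a hg x
    rw [hg, exp_smul_apply_eq, Real.exp_log a.2]
    rfl
  have hdirect : ∀ g ∈ screwHomotheties Φ, ∀ k ∈ (expGroup (𝔩 ⊓ skewOps (Euc n))).map (rotHom n),
      g * k = k * g := by
    rintro g ⟨a, hg⟩ _ ⟨f, hf, rfl⟩
    ext1 x
    change g (f x) = f (g x)
    rw [hscrew g a hg, hscrew g a hg]
    refine (expGroup_apply_comm (fun A hA => ?_) hf x).symm
    exact mul_exp_comm (sub_eq_zero.1 (smul_commutator_eq_zero (hcomm A hA.1 Z hZ𝔲) _)).symm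
  have hfix : ∀ g ∈ screwHomotheties Φ ⊔ (expGroup (𝔩 ⊓ skewOps (Euc n))).map (rotHom n),
      g 0 = 0 := by
    intro g hg
    obtain ⟨k, ⟨a, hk⟩, _, ⟨f, hf, rfl⟩, rfl⟩ := exists_mul_of_mem_sup hdirect hg
    change k (f 0) = 0
    rw [map_zero, hk, map_zero, smul_zero]
  refine ⟨expGroup (𝔩 ⊓ skewOps (Euc n)), expGroup_le_SOGroup hskew,
    isConnectedLieSubgroup_expGroup hskew fun A hA B hB => ⟨hS.commutator_mem_map_fst hA.1 hB.1,
      hA.2.isConformalOp.commutator_isSkewOp hB.2.isConformalOp⟩,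
    Φ, continuous_rotationFlow _ _, _, ⟨hdirect, ?_, rfl⟩, fun g _ τ hτ => ?_, ?_, ?_⟩
  · rw [Subgroup.disjoint_def]
    rintro g ⟨a, hg⟩ ⟨f, hf, rfl⟩
    ext1 x
    change f x = x
    by_cases hx : x = 0
    · rw [hx, map_zero]
    have h1 : f x = (a : ℝ) • (Φ a : OrthGroup n) x := hg x
    have h2 := congrArg norm h1
    rw [LinearIsometryEquiv.norm_map, norm_smul, LinearIsometryEquiv.norm_map,
      Real.norm_of_nonneg a.2.le] at h2
    have ha : a = 1 := Subtype.ext (mul_right_cancel₀ (norm_ne_zero_iff.2 hx)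
      (h2.symm.trans (one_mul _).symm))
    rw [h1, ha, map_one]
    exact one_smul ℝ x
  · exact conj_mem_translations (fun _ _ => Submodule.mem_top) hτ
  · rw [Subgroup.disjoint_def]
    exact fun hg hτ => eq_one_of_mem_translations hτ (hfix _ hg)
  · rw [sup_comm (screwHomotheties Φ)]
    refine hS.eq_sup hskew (fun A hA => hmem A hA.1 0)
      (fun v _ => mem_transPart.1 (hV ▸ Submodule.mem_top)) (fun _ _ _ _ => Submodule.mem_top)
      ?_ ?_
    · rintro k ⟨a, hk⟩
      refine ⟨_, hmem _ (𝔩.smul_mem (Real.log a) (h𝔲𝔩 hZ𝔲)) 0, affRep_eq_exp (map_zero _) ?_⟩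
      intro x
      rw [hscrew k a hk, add_zero]
    · intro p hp
      have hp𝔩 : p.1 ∈ 𝔩 := ⟨p, hp, rfl⟩
      obtain ⟨t, ht⟩ := (hS.conformal p hp).exists_sub_smul hZ
      have htZ : p.1 - t • Z ∈ 𝔩 := 𝔩.sub_mem hp𝔩 (𝔩.smul_mem t (h𝔲𝔩 hZ𝔲))
      obtain ⟨k, hk⟩ := hS.exists_exp _ (hmem _ (𝔩.smul_mem t (h𝔲𝔩 hZ𝔲)) 0)
      refine ⟨_, p.1 - t • Z, ⟨htZ, ht⟩, ⟨k, ⟨⟨Real.exp t, Real.exp_pos t⟩, fun x => ?_⟩, hk⟩,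
        (add_sub_cancel _ _).symm, Submodule.mem_top,
        smul_commutator_eq_zero (hcomm _ htZ Z hZ𝔲) t, map_zero _⟩
      rw [apply_eq_exp (map_zero _) hk, add_zero, exp_smul_apply_eq]
      change _ = Real.exp t • NormedSpace.exp (Real.log (Real.exp t) • (Z - 1)) x
      rw [Real.log_exp]

end IsSimLieAlgebra

/-! ### Groups of isometries -/

theorem apply_mem_of_mem_SOSub {n : ℕ} {W : Submodule ℝ (Euc n)} {f : OrthGroup n}
    (hf : f ∈ SOSub W) {w : Euc n} (hw : w ∈ W) : f w ∈ W := by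
  rw [← W.orthogonal_orthogonal, Submodule.mem_orthogonal]
  intro x hx
  rw [← hf.2 x hx, LinearIsometryEquiv.inner_map_map, real_inner_comm]
  exact (Submodule.mem_orthogonal W x).1 hx w hw

theorem clm_exp_eq_one {n : ℕ} {A : Euc n →L[ℝ] Euc n} (hA : A = 0) :
    NormedSpace.exp A = 1 := by
  rw [hA, NormedSpace.exp_zero]

/-- The homomorphism `u ↦ exp (Γ u)` for a linear family `Γ` of commuting skew operators that vanish
on `Wᗮ`. -/
noncomputable def screwRotation {n : ℕ} {W : Submodule ℝ (Euc n)}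
    (Γ : Wᗮ →ₗ[ℝ] (Euc n →L[ℝ] Euc n)) (hskew : ∀ u, IsSkewOp (Γ u))
    (hzero : ∀ u, ∀ x ∈ Wᗮ, Γ u x = 0) (hcomm : ∀ u v, Γ u * Γ v = Γ v * Γ u) :
    Multiplicative Wᗮ →* SOSub W where
  toFun u := ⟨expOrth (Γ u.toAdd) (hskew _), expOrth_mem_SOSub _ (hzero _)⟩
  map_one' := by
    refine Subtype.ext (linRep_injective n ?_)
    exact clm_exp_eq_one (map_zero Γ)
  map_mul' u v := by
    refine Subtype.ext (linRep_injective n ?_)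
    change NormedSpace.exp (Γ (u.toAdd + v.toAdd)) =
      NormedSpace.exp (Γ u.toAdd) * NormedSpace.exp (Γ v.toAdd)
    rw [map_add]
    exact clm_exp_add (hcomm _ _)

namespace IsSimLieAlgebra

variable {n : ℕ} {𝔰 : Submodule ℝ ((Euc n →L[ℝ] Euc n) × Euc n)} {G : Subgroup (AffGroup n)}

theorem isType4 (hS : IsSimLieAlgebra 𝔰 G) (htrans : ∀ x y : Euc n, ∃ g ∈ G, g x = y)
    (hskew : ∀ p ∈ 𝔰, IsSkewOp p.1)
    (hnorm : ∀ p ∈ 𝔰, ∀ q ∈ 𝔰, p.2 ∈ (transPart 𝔰)ᗮ → q.2 ∈ (transPart 𝔰)ᗮ → p.1 q.2 = 0) :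
    IsType4 G := by
  set W := transPart 𝔰
  set 𝔩 := 𝔰.map (LinearMap.fst ℝ (Euc n →L[ℝ] Euc n) (Euc n))
  set 𝔥 := 𝔰.comap (LinearMap.inl ℝ (Euc n →L[ℝ] Euc n) (Euc n))
  have hmem𝔥 : ∀ A, A ∈ 𝔥 ↔ (A, (0 : Euc n)) ∈ 𝔰 := fun A => Iff.rfl
  have hrep : ∀ B ∈ 𝔩, ∃ b ∈ Wᗮ, (B, b) ∈ 𝔰 := by
    rintro _ ⟨p, hp, rfl⟩
    obtain ⟨b, hb, hpb, -⟩ := exists_orthogonal_rep hp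
    exact ⟨b, hb, hpb⟩
  have hbr : ∀ B ∈ 𝔩, ∀ C ∈ 𝔩, B * C - C * B ∈ 𝔥 := by
    intro B hB C hC
    obtain ⟨b, hb, hBb⟩ := hrep B hB
    obtain ⟨c, hc, hCc⟩ := hrep C hC
    have h1 := hS.bracket_mem _ hBb _ hCc
    have h2 : B c - C b = 0 := by
      rw [show B c = 0 from hnorm _ hBb _ hCc hb hc, show C b = 0 from hnorm _ hCc _ hBb hc hb,
        sub_zero]
    rw [hmem𝔥, ← h2]
    exact h1
  have h𝔥𝔩 : 𝔥 ≤ 𝔩 := fun A hA => ⟨_, hA, rfl⟩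
  obtain ⟨𝔲, h𝔲𝔩, hdisj, hdec, hcomm⟩ := exists_central_complement (𝔩 := 𝔩) (𝔥 := 𝔥)
    (fun B hB => hS.conformal_of_mem_map_fst hB) h𝔥𝔩 hbr
  have hskew𝔩 : ∀ B ∈ 𝔩, IsSkewOp B := by
    rintro _ ⟨p, hp, rfl⟩
    exact hskew p hp
  let 𝔱 := 𝔰 ⊓ 𝔲.comap (LinearMap.fst ℝ (Euc n →L[ℝ] Euc n) (Euc n)) ⊓
    Wᗮ.comap (LinearMap.snd ℝ (Euc n →L[ℝ] Euc n) (Euc n))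
  have hdec' : ∀ p ∈ 𝔰, ∃ q ∈ 𝔱, ∃ A ∈ 𝔥, p.1 = q.1 + A ∧ p.2 - q.2 ∈ W := by
    intro p hp
    obtain ⟨b, hb, hpb, hbW⟩ := exists_orthogonal_rep hp
    obtain ⟨A, hA, C, hC, hpAC⟩ := hdec p.1 ⟨p, hp, rfl⟩
    refine ⟨(C, b), ⟨⟨?_, hC⟩, hb⟩, A, hA, hpAC, hbW⟩
    have h1 := 𝔰.sub_mem hpb ((hmem𝔥 A).1 hA)
    have h2 : (p.1, b) - (A, (0 : Euc n)) = (C, b) := by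
      refine Prod.ext ?_ (sub_zero b)
      change p.1 - A = C
      rw [hpAC, add_sub_cancel_right]
    rwa [h2] at h1
  have htop : W ⊔ 𝔱.map (LinearMap.snd ℝ (Euc n →L[ℝ] Euc n) (Euc n)) = ⊤ := by
    refine hS.eq_top_of_tangent htrans (x₀ := 0) (fun p hp v hv => ?_) fun p hp => ?_
    · obtain ⟨w, hw, _, ⟨q, hq, rfl⟩, rfl⟩ := Submodule.mem_sup.1 hv
      obtain ⟨b, hb, hpb, -⟩ := exists_orthogonal_rep hp
      have h1 : p.1 q.2 = 0 := hnorm _ hpb q hq.1.1 hb hq.2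
      rw [map_add]
      change p.1 w + p.1 q.2 ∈ _
      rw [h1, add_zero]
      exact Submodule.mem_sup_left (hS.apply_mem_transPart hp hw)
    · obtain ⟨q, hq, A, -, -, hqW⟩ := hdec' p hp
      rw [map_zero, zero_add, ← sub_add_cancel p.2 q.2]
      exact Submodule.add_mem_sup hqW ⟨q, hq, rfl⟩
  let β : 𝔱 →ₗ[ℝ] Wᗮ := ((LinearMap.snd ℝ (Euc n →L[ℝ] Euc n) (Euc n)).comp 𝔱.subtype).codRestrict
    Wᗮ fun q => q.2.2
  have hβ : ∀ q, (β q : Euc n) = q.1.2 := fun _ => rfl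
  have hβinj : Function.Injective β := by
    rw [injective_iff_map_eq_zero]
    rintro ⟨q, ⟨hq, hq𝔲⟩, hqW⟩ h
    have h2 : q.2 = 0 := congrArg Subtype.val h
    have h1 : q.1 = 0 := hdisj q.1 hq𝔲 ((hmem𝔥 _).2 (by rw [← h2]; exact hq))
    exact Subtype.ext (Prod.ext h1 h2)
  have hβsurj : Function.Surjective β := by
    intro u
    obtain ⟨w, hw, _, ⟨q, hq, rfl⟩, hsum⟩ :=
      Submodule.mem_sup.1 (htop ▸ Submodule.mem_top : (u : Euc n) ∈ _)
    refine ⟨⟨q, hq⟩, Subtype.ext ?_⟩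
    have hsum' : w + q.2 = u := hsum
    have hw0 : w = 0 := _root_.eq_zero_of_mem_orthogonal hw (by
      rw [eq_sub_of_add_eq hsum']
      exact Submodule.sub_mem _ u.2 hq.2)
    rw [hβ, ← hsum', hw0, zero_add]
  have hkill : ∀ B ∈ 𝔩, ∀ x ∈ Wᗮ, B x = 0 := by
    intro B hB x hx
    obtain ⟨b, hb, hBb⟩ := hrep B hB
    obtain ⟨q, hq⟩ := hβsurj ⟨x, hx⟩
    have hqx : q.1.2 = x := congrArg Subtype.val hq
    rw [← hqx]
    exact hnorm _ hBb q.1 q.2.1.1 hb q.2.2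
  let Γ : Wᗮ →ₗ[ℝ] (Euc n →L[ℝ] Euc n) := ((LinearMap.fst ℝ (Euc n →L[ℝ] Euc n) (Euc n)).comp
    𝔱.subtype).comp (LinearEquiv.ofBijective β ⟨hβinj, hβsurj⟩).symm.toLinearMap
  have hΓ : ∀ q, Γ (β q) = q.1.1 := by
    intro q
    change ((LinearEquiv.ofBijective β ⟨hβinj, hβsurj⟩).symm (β q)).1.1 = _
    rw [show β q = LinearEquiv.ofBijective β ⟨hβinj, hβsurj⟩ q from rfl,
      LinearEquiv.symm_apply_apply]
  have hΓ𝔲 : ∀ u, Γ u ∈ 𝔲 := fun u => by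
    obtain ⟨q, rfl⟩ := hβsurj u
    rw [hΓ]
    exact q.2.1.2
  have hΓ𝔰 : ∀ u, (Γ u, (u : Euc n)) ∈ 𝔰 := fun u => by
    obtain ⟨q, rfl⟩ := hβsurj u
    rw [hΓ]
    exact q.2.1.1
  have hΓinj : Function.Injective Γ := by
    rw [injective_iff_map_eq_zero]
    intro u hu
    have h1 := hΓ𝔰 u
    rw [hu] at h1
    exact Subtype.ext (eq_zero_of_mem_orthogonal h1 u.2)
  set Ψ := screwRotation Γ (fun u => hskew𝔩 _ (h𝔲𝔩 (hΓ𝔲 u))) (fun u => hkill _ (h𝔲𝔩 (hΓ𝔲 u)))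
    (fun u v => hcomm _ (h𝔲𝔩 (hΓ𝔲 u)) _ (hΓ𝔲 v))
  have hscrew : ∀ (g : AffGroup n) (u : Wᗮ),
      (∀ x, g x = (Ψ (Multiplicative.ofAdd u) : OrthGroup n) x + (u : Euc n)) →
      affRep n g = NormedSpace.exp (affGen n (Γ u, (u : Euc n))) := fun g u hg =>
    affRep_eq_exp (hkill _ (h𝔲𝔩 (hΓ𝔲 u)) _ u.2) hg
  have hHW : expGroup 𝔥 ≤ SOSub W := expGroup_le_SOSub (fun A hA => hskew𝔩 A (h𝔥𝔩 hA))
    fun A hA => hkill A (h𝔥𝔩 hA)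
  have hdirect : ∀ g ∈ (expGroup 𝔥).map (rotHom n), ∀ k ∈ screwIsometries W Ψ,
      g * k = k * g := by
    rintro _ ⟨f, hf, rfl⟩ k ⟨u, hk⟩
    ext1 x
    change f (k x) = k (f x)
    rw [hk, hk, map_add, (hHW hf).2 _ u.2]
    congr 1
    refine expGroup_apply_comm (T := NormedSpace.exp (Γ u)) (fun A hA => ?_) hf x
    exact mul_exp_comm (hcomm A (h𝔥𝔩 hA) _ (hΓ𝔲 u))
  have hform : ∀ g ∈ (expGroup 𝔥).map (rotHom n) ⊔ screwIsometries W Ψ,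
      ∃ f ∈ SOSub W, ∃ u ∈ Wᗮ, ∀ x, g x = f x + u := by
    intro g hg
    obtain ⟨_, ⟨f, hf, rfl⟩, k, ⟨u, hk⟩, rfl⟩ := exists_mul_of_mem_sup hdirect hg
    refine ⟨f * (Ψ (Multiplicative.ofAdd u) : OrthGroup n), mul_mem (hHW hf) (Subtype.property _),
      u, u.2, fun x => ?_⟩
    change f (k x) = f ((Ψ (Multiplicative.ofAdd u) : OrthGroup n) x) + u
    rw [hk, map_add, (hHW hf).2 _ u.2]
  refine ⟨W, expGroup 𝔥, hHW, isConnectedLieSubgroup_expGroup (fun A hA => hskew𝔩 A (h𝔥𝔩 hA))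
    (fun A hA B hB => hbr A (h𝔥𝔩 hA) B (h𝔥𝔩 hB)), Ψ, ?_, ⟨Γ.toContinuousLinearMap, ?_, hΓinj⟩, _,
    ⟨hdirect, ?_, rfl⟩, fun g hg τ hτ => conj_mem_translations (fun w hw => ?_) hτ, ?_, ?_⟩
  · exact continuous_clm_exp.comp Γ.continuous_of_finiteDimensional
  · have h1 : HasFDerivAt (NormedSpace.exp : (Euc n →L[ℝ] Euc n) → (Euc n →L[ℝ] Euc n))
        (1 : (Euc n →L[ℝ] Euc n) →L[ℝ] (Euc n →L[ℝ] Euc n)) (Γ.toContinuousLinearMap 0) := by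
      rw [map_zero]
      exact hasFDerivAt_exp_zero
    exact h1.comp (0 : Wᗮ) Γ.toContinuousLinearMap.hasFDerivAt
  · rw [Subgroup.disjoint_def]
    rintro _ ⟨f, hf, rfl⟩ ⟨u, hk⟩
    have hu : (u : Euc n) = 0 := by
      have h0 := hk 0
      rw [rotHom_apply, map_zero, map_zero, zero_add] at h0
      exact h0.symm
    have hu0 : u = 0 := Subtype.ext hu
    ext1 x
    rw [hk, hu0, ofAdd_zero, map_one]
    exact add_zero x
  · obtain ⟨f, hf, u, -, hg⟩ := hform g hg
    have h1 : g.linear w = f w := by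
      have := affEquiv_apply g w
      rw [hg w, hg 0, map_zero, zero_add] at this
      exact (add_right_cancel this).symm
    rw [h1]
    exact apply_mem_of_mem_SOSub hf hw
  · rw [Subgroup.disjoint_def]
    intro g hg hτ
    obtain ⟨f, hf, u, hu, hgf⟩ := hform g hg
    have h0 : g 0 = u := by rw [hgf, map_zero, zero_add]
    refine eq_one_of_mem_translations hτ ?_
    obtain ⟨w, hw, hgw⟩ := hτ
    have h1 : u = w := by rw [← h0, hgw, zero_add]
    rw [h0]
    exact _root_.eq_zero_of_mem_orthogonal (h1 ▸ hw) hu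
  · refine hS.eq_sup (fun A hA => hskew𝔩 A (h𝔥𝔩 hA)) (fun A hA => hA) (fun v hv => hv)
      (fun p hp v hv => hS.apply_mem_transPart hp hv) ?_ ?_
    · rintro k ⟨u, hk⟩
      exact ⟨_, hΓ𝔰 u, hscrew k u hk⟩
    · intro p hp
      obtain ⟨q, hq, A, hA, h1, h2⟩ := hdec' p hp
      obtain ⟨k, hk⟩ := hS.exists_exp q hq.1.1
      refine ⟨q, A, hA, ⟨k, ⟨β ⟨q, hq⟩, fun x => ?_⟩, hk⟩, h1, h2,
        sub_eq_zero.2 (hcomm A (h𝔥𝔩 hA) _ hq.1.2).symm, hkill A (h𝔥𝔩 hA) _ hq.2⟩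
      have h3 := apply_eq_exp (hkill _ (h𝔲𝔩 hq.1.2) _ hq.2) hk x
      have h4 : NormedSpace.exp q.1 = NormedSpace.exp (Γ (β ⟨q, hq⟩)) := by rw [hΓ]
      refine h3.trans (congrArg (· + q.2) ?_)
      exact congrArg (fun S : Euc n →L[ℝ] Euc n => S x) h4

theorem exists_isType4 (hS : IsSimLieAlgebra 𝔰 G) (htrans : ∀ x y : Euc n, ∃ g ∈ G, g x = y)
    (hskew : ∀ p ∈ 𝔰, IsSkewOp p.1) :
    ∃ c ∈ Sim0 n, IsType4 (G.map (MulAut.conj c).toMonoidHom) := by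
  obtain ⟨p, hp⟩ := exists_cocycle_normalization
    (𝔨 := 𝔰 ⊓ (transPart 𝔰)ᗮ.comap (LinearMap.snd ℝ (Euc n →L[ℝ] Euc n) (Euc n)))
    (fun X hX Y hY => ⟨hS.bracket_mem X hX.1 Y hY.1, Submodule.sub_mem _
      (hS.apply_mem_orthogonal hX.1 hY.2) (hS.apply_mem_orthogonal hY.1 hX.2)⟩)
    (fun X hX => hskew X hX.1)
    (fun X hX h0 => Prod.ext h0 (eq_zero_of_mem_orthogonal (𝔰 := 𝔰) (by
      rw [← h0]; exact hX.1) hX.2))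
  set w := (transPart 𝔰).starProjection p
  have hwV : w ∈ transPart 𝔰 := Submodule.starProjection_apply_mem _ _
  have hq : p - w ∈ (transPart 𝔰)ᗮ := Submodule.sub_starProjection_mem_orthogonal _
  set q := p - w with hqdef
  have hkey : ∀ X ∈ 𝔰, ∀ Y ∈ 𝔰, X.2 ∈ (transPart 𝔰)ᗮ → Y.2 ∈ (transPart 𝔰)ᗮ →
      X.1 (Y.2 - Y.1 q) = 0 := by
    intro X hX Y hY hX2 hY2
    have h1 := hp X ⟨hX, hX2⟩ Y ⟨hY, hY2⟩
    have h2 : X.1 (Y.2 - Y.1 q) = X.1 (Y.1 w) := by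
      have : Y.2 - Y.1 q = (Y.2 - Y.1 p) + Y.1 w := by
        rw [hqdef, map_sub]
        abel
      rw [this, map_add, h1, zero_add]
    refine _root_.eq_zero_of_mem_orthogonal (V := transPart 𝔰) ?_ ?_
    · rw [h2]
      exact hS.apply_mem_transPart hX (hS.apply_mem_transPart hY hwV)
    · exact hS.apply_mem_orthogonal hX (Submodule.sub_mem _ hY2 (hS.apply_mem_orthogonal hY hq))
  let c : AffGroup n := AffineEquiv.constVAdd ℝ (Euc n) q
  have hc : ∀ x, c x = x + q := fun x => add_comm q x
  refine ⟨c, ⟨1, 1, one_mem _, q, fun x => ?_⟩, isType4 (hS.translate q hc) ?_ ?_ ?_⟩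
  · rw [hc]
    congr 1
    exact (one_smul ℝ x).symm
  · intro x y
    obtain ⟨g, hg, hgx⟩ := htrans (c⁻¹ x) (c⁻¹ y)
    refine ⟨c * g * c⁻¹, ⟨g, hg, rfl⟩, ?_⟩
    change c (g (c⁻¹ x)) = y
    rw [hgx]
    exact c.apply_symm_apply y
  · intro X hX
    exact hskew (X.1, X.2 + X.1 q) (mem_translateAlgebra.1 hX)
  · intro X hX Y hY hX2 hY2
    rw [transPart_translateAlgebra] at hX2 hY2
    rw [mem_translateAlgebra] at hX hY
    have h1 := hkey _ hX _ hY
      (Submodule.add_mem _ hX2 (hS.apply_mem_orthogonal hX hq))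
      (Submodule.add_mem _ hY2 (hS.apply_mem_orthogonal hY hq))
    simpa using h1

end IsSimLieAlgebra

/-! ### Transitivity of the groups in the list -/

theorem transitive_of_translations_le {n : ℕ} {K : Subgroup (AffGroup n)}
    (h : translations ⊤ ≤ K) (x y : Euc n) : ∃ g ∈ K, g x = y := by
  refine ⟨AffineEquiv.constVAdd ℝ (Euc n) (y - x), h ⟨y - x, trivial, fun z => add_comm _ z⟩, ?_⟩
  exact sub_add_cancel y x

theorem IsType4.transitive {n : ℕ} {K : Subgroup (AffGroup n)} (hK : IsType4 K) (x y : Euc n) :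
    ∃ g ∈ K, g x = y := by
  obtain ⟨W, H, -, -, Ψ, -, -, D, ⟨-, -, hD⟩, -, -, rfl⟩ := hK
  let u : Wᗮ := ⟨(y - x) - W.starProjection (y - x),
    Submodule.sub_starProjection_mem_orthogonal _⟩
  let f : OrthGroup n := (Ψ (Multiplicative.ofAdd u)).1
  let k : AffGroup n := AffineEquiv.constVAdd ℝ (Euc n) (u : Euc n) * rotHom n f
  have hk : ∀ z, k z = f z + u := fun z => add_comm _ _
  have hkD : k ∈ D := by
    rw [hD]
    exact Subgroup.mem_sup_right ⟨u, hk⟩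
  have hW : y - k x ∈ W := by
    have h1 : f x - x ∈ W := by
      have hx : x - W.starProjection x ∈ Wᗮ := Submodule.sub_starProjection_mem_orthogonal _
      have h2 : f (x - W.starProjection x) = x - W.starProjection x :=
        (Ψ (Multiplicative.ofAdd u)).2.2 _ hx
      have h3 : f (W.starProjection x) ∈ W := apply_mem_of_mem_SOSub
        (Ψ (Multiplicative.ofAdd u)).2 (Submodule.starProjection_apply_mem _ _)
      rw [map_sub] at h2
      have h4 : f x - x = f (W.starProjection x) - W.starProjection x := by
        rw [sub_eq_sub_iff_sub_eq_sub]; exact h2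
      rw [h4]
      exact W.sub_mem h3 (Submodule.starProjection_apply_mem _ _)
    have h5 : y - k x = W.starProjection (y - x) - (f x - x) := by
      rw [hk]
      change y - (f x + ((y - x) - W.starProjection (y - x))) = _
      abel
    rw [h5]
    exact W.sub_mem (Submodule.starProjection_apply_mem _ _) h1
  refine ⟨AffineEquiv.constVAdd ℝ (Euc n) (y - k x) * k, mul_mem
    (Subgroup.mem_sup_right ⟨y - k x, hW, fun z => add_comm _ z⟩) (Subgroup.mem_sup_left hkD), ?_⟩
  exact sub_add_cancel y (k x)

theorem theorem12 (n : ℕ) (G : Subgroup (AffGroup n)) (hG : G ≤ Sim0 n)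
    (hconn : IsConnectedLieSubgroup (affRep n) G) :
    (∀ x y : Euc n, ∃ g ∈ G, g x = y) ↔
      ∃ c ∈ Sim0 n, ∃ K : Subgroup (AffGroup n),
        K = G.map (MulAut.conj c).toMonoidHom ∧
          (IsType1 K ∨ IsType2 K ∨ IsType3 K ∨ IsType4 K) := by
  constructor
  · intro htrans
    obtain ⟨𝔰, hS⟩ := exists_isSimLieAlgebra hG hconn
    by_cases hns : ∃ p ∈ 𝔰, ¬IsSkewOp p.1
    · refine ⟨1, one_mem _, G, ?_, Or.inr (Or.inr (Or.inl (hS.isType3 htrans hns)))⟩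
      rw [map_one]
      exact (Subgroup.map_id G).symm
    · push Not at hns
      obtain ⟨c, hc, h4⟩ := hS.exists_isType4 htrans hns
      exact ⟨c, hc, _, rfl, Or.inr (Or.inr (Or.inr h4))⟩
  · rintro ⟨c, -, K, hK, htype⟩ x y
    have hKtrans : ∀ x y : Euc n, ∃ g ∈ K, g x = y := by
      rcases htype with ⟨_, -, -, D, -, -, -, rfl⟩ | ⟨_, -, -, -, -, rfl⟩ |
        ⟨_, -, -, _, -, D, -, -, -, rfl⟩ | h4
      · exact transitive_of_translations_le le_sup_right
      · exact transitive_of_translations_le le_sup_right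
      · exact transitive_of_translations_le le_sup_right
      · exact h4.transitive
    obtain ⟨k, hk, hkx⟩ := hKtrans (c x) (c y)
    rw [hK] at hk
    obtain ⟨g, hg, rfl⟩ := hk
    refine ⟨g, hg, c.injective ?_⟩
    rw [← hkx]
    change _ = c (g (c.symm (c x)))
    rw [AffineEquiv.symm_apply_apply]
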